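/- **Theorem tw.sob14.** Let $E$ be a locally compact separable metric space, $m$ a Borel measure on $E$ that is finite on compact sets and strictly positive on nonempty open sets, $H=L^2(E;m)$ (real) and $T>0$. Let $\{(B^{(t)},V),\,t\in[0,T]\}$ be a family of regular (not necessarily symmetric) Dirichlet forms on $H$ with common domain $V\subset H$ and associated operators $L_t$. Write $B^{(t)}_1(\varphi,\psi)=B^{(t)}(\varphi,\psi)+(\varphi,\psi)_H$ and assume that (a) there is $K\ge 0$ with $|B^{(t)}_1(\varphi,\psi)|\le K\,B^{(t)}_1(\varphi,\varphi)^{1/2}B^{(t)}_1(\psi,\psi)^{1/2}$ for all $\varphi,\psi\in V$, $t\in[0,T]$; (b) $[0,T]\ni t\mapsto B^{(t)}(\varphi,\psi)$ is measurable for all $\varphi,\psi\in V$; (c) there is $c\ge1$ with $c^{-1}B^{(0)}(\varphi,\varphi)\le B^{(t)}(\varphi,\varphi)\le c\,B^{(0)}(\varphi,\varphi)$ for all $\varphi\in V$, $t\in[0,T]$. Equip $V$ with the norm $\|\varphi\|_V^2=B^{(0)}_1(\varphi,\varphi)$, let $V'$ be its dual, identify $H$ with $H'$, so that $V\subset H\subset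 V'$, and let $\mathcal H=L^2(0,T;H)$, $\mathcal V=L^2(0,T;V)$, $\mathcal V'=L^2(0,T;V')$, with $\langle\cdot,\cdot\rangle$ the duality between $\mathcal V'$ and $\mathcal V$. Let $$\mathcal W_0=\{u\in\mathcal V:\ \partial_t u\in\mathcal V',\ u(0)=0\},\qquad \|u\|_{\mathcal W}=\|u\|_{\mathcal V}+\|\partial_t u\|_{\mathcal V'},$$ where $\partial_t$ is the distributional derivative on $(0,T)$ and such $u$ are identified with their versions in $C([0,T];H)$; let $\mathcal W_0'$ be the dual of $\mathcal W_0$ and $\langle\langle\cdot,\cdot\rangle\rangle$ the corresponding duality. Let $g\in\mathcal W_0'$, $\varphi\in H$, and let $f:(0,T)\times E\times\mathbb R\to\mathbb R$ be measurable, with $y\mapsto f(x,y)$ continuous for every $x\in(0,T)\times E$. Suppose that there are $\lambda\in\mathbb R$, $M\ge0$ and a positive $\varrho\in\mathcal H=L^2((0,T)\times E;dt\otimes m)$ such that for all $x\in(0,T)\times E$ and $y,y'\in\mathbb R$ $$|f(x,y)|\le\varrho(x)+M|y|,\qquad (f(x,y)-f(x,y'))(y-y')\le\lambda|y-y'|^2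 .$$ Then the Cauchy problem $-\partial_t u-L_t u=f(\cdot,u)+g$, $u(T,\cdot)=\varphi$, has a unique solution, i.e. there is exactly one $u\in\mathcal V$ such that $$\langle\partial_t\eta,u\rangle+\int_0^T B^{(t)}(u(t),\eta(t))\,dt=(\varphi,\eta(T))_H+(f(\cdot,u),\eta)_{\mathcal H}+\langle\langle g,\eta\rangle\rangle\qquad\text{for all }\eta\in\mathcal W_0 .$$ -/

import Mathlib

open MeasureTheory Set Filter Topology
open scoped ContDiff RealInnerProductSpace

noncomputable section

namespace ParabolicDirichlet

section Forms

variable {E : Type*} [MetricSpace E] [MeasurableSpace E]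

/-- `b_α(φ, ψ) = b(φ, ψ) + α (φ, ψ)_H`, where `H = L²(E; m)`. -/
def shift {m : Measure E} {V : Submodule ℝ (Lp ℝ 2 m)} (b : V →ₗ[ℝ] V →ₗ[ℝ] ℝ) (α : ℝ)
    (φ ψ : V) : ℝ :=
  b φ ψ + α * ⟪(φ : Lp ℝ 2 m), (ψ : Lp ℝ 2 m)⟫

/-- The class `φ ∈ L²(E; m)` has a continuous, compactly supported version `h`. -/
def IsCcVersion {m : Measure E} (φ : Lp ℝ 2 m) (h : E → ℝ) : Prop :=
  Continuous h ∧ HasCompactSupport h ∧ φ =ᵐ[m] h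

/-- `(b, V)` is a regular (in general non-symmetric) Dirichlet form on `L²(E; m)`. -/
structure IsRegularDirichletForm (m : Measure E) (V : Submodule ℝ (Lp ℝ 2 m))
    (b : V →ₗ[ℝ] V →ₗ[ℝ] ℝ) : Prop where
  /-- the domain is dense in `L²(E; m)` -/
  dense_dom : Dense (V : Set (Lp ℝ 2 m))
  /-- the form is positive -/
  nonneg : ∀ φ : V, 0 ≤ b φ φ
  /-- the form is closed: `V` is complete for the norm `b₁(φ, φ)^{1/2}` -/
  closed : ∀ s : ℕ → V,
    (∀ ε > 0, ∃ N, ∀ n ≥ N, ∀ k ≥ N, shift b 1 (s n - s k) (s n - s k) < ε) →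
    ∃ φ : V, Tendsto (fun n => shift b 1 (s n - φ) (s n - φ)) atTop (𝓝 0)
  /-- the weak sector condition -/
  sector : ∃ K : ℝ, 0 ≤ K ∧ ∀ φ ψ : V,
    |shift b 1 φ ψ| ≤ K * (√(shift b 1 φ φ) * √(shift b 1 ψ ψ))
  /-- the unit contraction `ψ = φ⁺ ∧ 1` operates on the form, in both arguments -/
  contraction : ∀ φ : V, ∃ ψ : V,
    ((ψ : Lp ℝ 2 m) : E → ℝ) =ᵐ[m] (fun x => min (max ((φ : Lp ℝ 2 m) x) 0) 1) ∧
    0 ≤ b (φ + ψ) (φ - ψ) ∧ 0 ≤ b (φ - ψ) (φ + ψ)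
  /-- `C_c(E) ∩ V` is dense in `V` for the norm `b₁(φ, φ)^{1/2}` -/
  regular_dom : ∀ φ : V, ∀ ε > 0, ∃ ψ : V,
    (∃ h, IsCcVersion (ψ : Lp ℝ 2 m) h) ∧ shift b 1 (φ - ψ) (φ - ψ) < ε
  /-- `C_c(E) ∩ V` is dense in `C_c(E)` for the uniform norm -/
  regular_unif : ∀ h : E → ℝ, Continuous h → HasCompactSupport h → ∀ ε > 0,
    ∃ (ψ : V) (k : E → ℝ), IsCcVersion (ψ : Lp ℝ 2 m) k ∧ ∀ x, |h x - k x| < ε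

/-- A family `{(B^{(t)}, V), t ∈ [0, T]}`, `T > 0`, of regular Dirichlet forms on `L²(E; m)` with
common domain `V`, measurable in `t`, with a uniform sector condition, and with
`B^{(t)}(φ, φ)` uniformly comparable to `B^{(0)}(φ, φ)`. (The values of `B` off `[0, T]` are
irrelevant.) -/
structure FormFamily (m : Measure E) (T : ℝ) where
  T_pos : 0 < T
  V : Submodule ℝ (Lp ℝ 2 m)
  B : ℝ → V →ₗ[ℝ] V →ₗ[ℝ] ℝ
  isForm : ∀ t ∈ Icc 0 T, IsRegularDirichletForm m V (B t)
  sector : ∃ K : ℝ, 0 ≤ K ∧ ∀ t ∈ Icc 0 T, ∀ φ ψ : V,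
    |shift (B t) 1 φ ψ| ≤ K * (√(shift (B t) 1 φ φ) * √(shift (B t) 1 ψ ψ))
  measurable : ∀ φ ψ : V, AEMeasurable (fun t => B t φ ψ) (volume.restrict (Icc 0 T))
  comparable : ∃ c : ℝ, 1 ≤ c ∧ ∀ t ∈ Icc 0 T, ∀ φ : V,
    c⁻¹ * B 0 φ φ ≤ B t φ φ ∧ B t φ φ ≤ c * B 0 φ φ

end Forms

/-- Lebesgue measure on `(0, T)`. -/
abbrev timeMeasure (T : ℝ) : Measure ℝ := volume.restrict (Ioo 0 T)

namespace FormFamily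

variable {E : Type*} [MetricSpace E] [MeasurableSpace E] {m : Measure E} {T : ℝ}

theorem form_zero (D : FormFamily m T) : IsRegularDirichletForm m D.V (D.B 0) :=
  D.isForm 0 ⟨le_rfl, D.T_pos.le⟩

/-- The symmetric part of `B^{(0)}₁`, as an inner product on `V`. -/
@[reducible] def core (D : FormFamily m T) : InnerProductSpace.Core ℝ D.V where
  inner φ ψ := (D.B 0 φ ψ + D.B 0 ψ φ) / 2 + ⟪(φ : Lp ℝ 2 m), (ψ : Lp ℝ 2 m)⟫
  conj_inner_symm φ ψ := by
    simp only [conj_trivial]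
    rw [real_inner_comm (φ : Lp ℝ 2 m) (ψ : Lp ℝ 2 m), add_comm (D.B 0 ψ φ)]
  re_inner_nonneg φ := by
    have h1 : 0 ≤ D.B 0 φ φ := D.form_zero.nonneg φ
    have h2 : 0 ≤ ⟪(φ : Lp ℝ 2 m), (φ : Lp ℝ 2 m)⟫ := real_inner_self_nonneg
    simp only [RCLike.re_to_real]
    linarith
  add_left φ ψ χ := by
    simp only [map_add, LinearMap.add_apply, Submodule.coe_add, inner_add_left]
    ring
  smul_left φ ψ r := by
    simp only [map_smul, LinearMap.smul_apply, smul_eq_mul, Submodule.coe_smul,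
      real_inner_smul_left, conj_trivial]
    ring
  definite φ h := by
    have h1 : 0 ≤ D.B 0 φ φ := D.form_zero.nonneg φ
    have h2 : 0 ≤ ⟪(φ : Lp ℝ 2 m), (φ : Lp ℝ 2 m)⟫ := real_inner_self_nonneg
    have h3 : ⟪(φ : Lp ℝ 2 m), (φ : Lp ℝ 2 m)⟫ = 0 := by
      have h4 : (D.B 0 φ φ + D.B 0 φ φ) / 2 + ⟪(φ : Lp ℝ 2 m), (φ : Lp ℝ 2 m)⟫ = 0 := h
      linarith
    exact Subtype.ext (inner_self_eq_zero.mp h3)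

/-- The common domain `V`, as a type of its own: it carries the norm
`‖φ‖_V² = B^{(0)}(φ, φ) + (φ, φ)_H` and not the norm of `L²(E; m)`. -/
def Dom (D : FormFamily m T) : Type _ := D.V

instance (D : FormFamily m T) : NormedAddCommGroup D.Dom :=
  @InnerProductSpace.Core.toNormedAddCommGroup ℝ D.V _ _ _ D.core

instance (D : FormFamily m T) : InnerProductSpace ℝ D.Dom :=
  @InnerProductSpace.ofCore ℝ D.V _ _ _ D.core.toCore

/-- The inclusion `V ⊂ L²(E; m)`, as a linear map. -/
def incl (D : FormFamily m T) : D.Dom →ₗ[ℝ] Lp ℝ 2 m := D.V.subtype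

/-- The form `B^{(t)}` on `V`. -/
def form (D : FormFamily m T) (t : ℝ) : D.Dom →ₗ[ℝ] D.Dom →ₗ[ℝ] ℝ := D.B t

theorem norm_sq_eq (D : FormFamily m T) (φ : D.Dom) :
    ‖φ‖ ^ 2 = D.form 0 φ φ + ⟪D.incl φ, D.incl φ⟫ := by
  rw [← real_inner_self_eq_norm_sq]
  change (D.form 0 φ φ + D.form 0 φ φ) / 2 + ⟪D.incl φ, D.incl φ⟫ = _
  ring

theorem norm_incl_le (D : FormFamily m T) (φ : D.Dom) : ‖D.incl φ‖ ≤ 1 * ‖φ‖ := by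
  rw [one_mul]
  refine le_of_sq_le_sq ?_ (norm_nonneg _)
  have h1 : 0 ≤ D.form 0 φ φ := D.form_zero.nonneg φ
  rw [D.norm_sq_eq, real_inner_self_eq_norm_sq]
  linarith

/-- The continuous inclusion `V ⊂ H = L²(E; m)`. -/
def toH (D : FormFamily m T) : D.Dom →L[ℝ] Lp ℝ 2 m := D.incl.mkContinuous 1 D.norm_incl_le

/-- The embedding `V ⊂ H ≃ H' ⊂ V'`, that is `φ ↦ (φ, ·)_H`. -/
def toDual (D : FormFamily m T) : D.Dom →L[ℝ] StrongDual ℝ D.Dom :=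
  ((ContinuousLinearMap.compL ℝ D.Dom (Lp ℝ 2 m) ℝ).flip D.toH).comp
    ((innerSL ℝ).comp D.toH)

theorem toDual_apply (D : FormFamily m T) (φ ψ : D.Dom) :
    D.toDual φ ψ = ⟪D.toH φ, D.toH ψ⟫ := rfl

/-- `L²(0, T; V)`, with the norm `(∫₀ᵀ ‖u(t)‖_V² dt)^{1/2}`. -/
abbrev L2V (D : FormFamily m T) : Type _ := Lp D.Dom 2 (timeMeasure T)

/-- `L²(0, T; V')`, with the norm `(∫₀ᵀ ‖w(t)‖_{V'}² dt)^{1/2}`. -/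
abbrev L2V' (D : FormFamily m T) : Type _ := Lp (StrongDual ℝ D.Dom) 2 (timeMeasure T)

/-- `w ∈ L²(0, T; V')` is the derivative `∂_t u` of `u ∈ L²(0, T; V)` in the sense of
(`V'`-valued) distributions on `(0, T)`. -/
def IsTimeDeriv (D : FormFamily m T) (u : D.L2V) (w : D.L2V') : Prop :=
  ∀ θ : ℝ → ℝ, ContDiff ℝ ∞ θ → HasCompactSupport θ → tsupport θ ⊆ Ioo 0 T →
    ∫ t in Ioo 0 T, deriv θ t • D.toDual (u t) = - ∫ t in Ioo 0 T, θ t • w t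

/-- `v` is the version of `u` in `C([0, T]; H)`. -/
def IsContVersion (D : FormFamily m T) (u : D.L2V) (v : ℝ → Lp ℝ 2 m) : Prop :=
  ContinuousOn v (Icc 0 T) ∧ ∀ᵐ t ∂(timeMeasure T), v t = D.toH (u t)

theorem integrable_smul {F : Type*} [NormedAddCommGroup F] [NormedSpace ℝ F] {θ : ℝ → ℝ}
    (hc : Continuous θ) (hs : HasCompactSupport θ) {u : ℝ → F} (hu : MemLp u 2 (timeMeasure T)) :
    Integrable (fun t => θ t • u t) (timeMeasure T) := by
  obtain ⟨C, hC⟩ := hs.exists_bound_of_continuous hc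
  have hu1 : Integrable u (timeMeasure T) := hu.integrable (by norm_num)
  exact hu1.bdd_smul C hc.aestronglyMeasurable (Eventually.of_forall hC)

theorem memLp_toDual (D : FormFamily m T) (u : D.L2V) :
    MemLp (fun t => D.toDual (u t)) 2 (timeMeasure T) :=
  D.toDual.comp_memLp' (Lp.memLp u)

theorem isTimeDeriv_zero (D : FormFamily m T) : D.IsTimeDeriv 0 0 := by
  intro θ _ _ _
  have h1 : ∫ t in Ioo 0 T, deriv θ t • D.toDual ((0 : D.L2V) t) = 0 := by
    rw [← integral_zero ℝ (StrongDual ℝ D.Dom) (μ := timeMeasure T)]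
    refine integral_congr_ae ?_
    filter_upwards [Lp.coeFn_zero D.Dom 2 (timeMeasure T)] with t ht
    rw [ht]; simp
  have h2 : ∫ t in Ioo 0 T, θ t • (0 : D.L2V') t = 0 := by
    rw [← integral_zero ℝ (StrongDual ℝ D.Dom) (μ := timeMeasure T)]
    refine integral_congr_ae ?_
    filter_upwards [Lp.coeFn_zero (StrongDual ℝ D.Dom) 2 (timeMeasure T)] with t ht
    rw [ht]; simp
  rw [h1, h2, neg_zero]

theorem IsTimeDeriv.add {D : FormFamily m T} {u u' : D.L2V} {w w' : D.L2V'}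
    (h : D.IsTimeDeriv u w) (h' : D.IsTimeDeriv u' w') : D.IsTimeDeriv (u + u') (w + w') := by
  intro θ hθ hs ht
  have hd : Continuous (deriv θ) := hθ.continuous_deriv (by simp)
  have h1 : ∫ t in Ioo 0 T, deriv θ t • D.toDual ((u + u') t)
      = (∫ t in Ioo 0 T, deriv θ t • D.toDual (u t))
        + ∫ t in Ioo 0 T, deriv θ t • D.toDual (u' t) := by
    rw [← integral_add (integrable_smul hd hs.deriv (D.memLp_toDual u))
      (integrable_smul hd hs.deriv (D.memLp_toDual u'))]
    refine integral_congr_ae ?_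
    filter_upwards [Lp.coeFn_add u u'] with t ht
    rw [ht]; simp
  have h2 : ∫ t in Ioo 0 T, θ t • (w + w') t
      = (∫ t in Ioo 0 T, θ t • w t) + ∫ t in Ioo 0 T, θ t • w' t := by
    rw [← integral_add (integrable_smul hθ.continuous hs (Lp.memLp w))
      (integrable_smul hθ.continuous hs (Lp.memLp w'))]
    refine integral_congr_ae ?_
    filter_upwards [Lp.coeFn_add w w'] with t ht
    rw [ht]; simp
  rw [h1, h2, h θ hθ hs ht, h' θ hθ hs ht, neg_add]

theorem IsTimeDeriv.smul {D : FormFamily m T} {u : D.L2V} {w : D.L2V'} (r : ℝ)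
    (h : D.IsTimeDeriv u w) : D.IsTimeDeriv (r • u) (r • w) := by
  intro θ hθ hs ht
  have h1 : ∫ t in Ioo 0 T, deriv θ t • D.toDual ((r • u) t)
      = r • ∫ t in Ioo 0 T, deriv θ t • D.toDual (u t) := by
    rw [← integral_smul]
    refine integral_congr_ae ?_
    filter_upwards [Lp.coeFn_smul r u] with t ht
    rw [ht]; simp [smul_comm r]
  have h2 : ∫ t in Ioo 0 T, θ t • (r • w) t = r • ∫ t in Ioo 0 T, θ t • w t := by
    rw [← integral_smul]
    refine integral_congr_ae ?_
    filter_upwards [Lp.coeFn_smul r w] with t ht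
    rw [ht]; simp [smul_comm r]
  rw [h1, h2, h θ hθ hs ht, smul_neg]

/-- The space `W₀ = {η ∈ L²(0, T; V) : ∂_t η ∈ L²(0, T; V'), η(0) = 0}`, realised as the space of
pairs `(η, ∂_t η)`; the second entry is determined by the first. Its norm here,
`max (‖η‖, ‖∂_t η‖)`, is equivalent to `‖η‖ + ‖∂_t η‖`, so that `StrongDual ℝ D.W0` is the
dual space `W₀'`. The value `η(0)` is that of the version of `η` in `C([0, T]; H)`. -/
def W0 (D : FormFamily m T) : Submodule ℝ (D.L2V × D.L2V') where
  carrier := {p | D.IsTimeDeriv p.1 p.2 ∧ ∃ v, D.IsContVersion p.1 v ∧ v 0 = 0}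
  zero_mem' := by
    refine ⟨D.isTimeDeriv_zero, 0, ⟨continuousOn_const, ?_⟩, rfl⟩
    filter_upwards [Lp.coeFn_zero D.Dom 2 (timeMeasure T)] with t ht
    rw [Prod.fst_zero, ht]; simp
  add_mem' := by
    rintro p q ⟨hp, v, ⟨hv, hv'⟩, hv0⟩ ⟨hq, z, ⟨hz, hz'⟩, hz0⟩
    refine ⟨hp.add hq, v + z, ⟨hv.add hz, ?_⟩, by simp [hv0, hz0]⟩
    filter_upwards [hv', hz', Lp.coeFn_add p.1 q.1] with t h1 h2 h3
    rw [Prod.fst_add, h3]; simp [h1, h2]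
  smul_mem' := by
    rintro r p ⟨hp, v, ⟨hv, hv'⟩, hv0⟩
    refine ⟨hp.smul r, r • v, ⟨hv.const_smul r, ?_⟩, by simp [hv0]⟩
    filter_upwards [hv', Lp.coeFn_smul r p.1] with t h1 h2
    rw [Prod.smul_fst, h2]; simp [h1]

/-- `u ∈ L²(0, T; V)` is a weak solution of `-∂_t u - L_t u = f(·, u) + g`, `u(T) = φ`: the function
`F = f(·, u)` belongs to `L²(0, T; H)`, and for every `η ∈ W₀`
`⟨∂_t η, u⟩ + ∫₀ᵀ B^{(t)}(u(t), η(t)) dt = (φ, η(T))_H + (f(·, u), η) + ⟨⟨g, η⟩⟩`,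
where `η(T)` is the value at `T` of the version `v` of `η` in `C([0, T]; H)`. -/
def IsWeakSolution (D : FormFamily m T) (f : ℝ → E → ℝ → ℝ) (φ : Lp ℝ 2 m)
    (g : StrongDual ℝ D.W0) (u : D.L2V) : Prop :=
  ∃ F : Lp (Lp ℝ 2 m) 2 (timeMeasure T),
    (∀ᵐ t ∂(timeMeasure T), F t =ᵐ[m] fun x => f t x (D.toH (u t) x)) ∧
    ∀ (η : D.W0) (v : ℝ → Lp ℝ 2 m), D.IsContVersion η.1.1 v →
      (∫ t in Ioo 0 T, (η.1.2 t) (u t)) + (∫ t in Ioo 0 T, D.form t (u t) (η.1.1 t))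
        = ⟪φ, v T⟫ + (∫ t in Ioo 0 T, ⟪F t, D.toH (η.1.1 t)⟫) + g η

end FormFamily

/-- `f : (0, T) × E × ℝ → ℝ` is measurable, continuous in the last variable, and for some
`lam ∈ ℝ`, `M ≥ 0` and some positive `ϱ ∈ L²((0, T) × E; dt ⊗ m)`, for all `(t, x) ∈ (0, T) × E` and
`y, y' ∈ ℝ`, `|f(t, x, y)| ≤ ϱ(t, x) + M |y|` and
`(f(t, x, y) - f(t, x, y')) (y - y') ≤ lam |y - y'|²`. -/
structure IsAdmissible {E : Type*} [MeasurableSpace E] (m : Measure E) (T : ℝ)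
    (f : ℝ → E → ℝ → ℝ) : Prop where
  measurable : Measurable (fun p : Ioo (0 : ℝ) T × E × ℝ => f p.1 p.2.1 p.2.2)
  continuous : ∀ t ∈ Ioo 0 T, ∀ x, Continuous (f t x)
  growth : ∃ (M : ℝ) (ϱ : ℝ × E → ℝ), 0 ≤ M ∧ (∀ p, 0 ≤ ϱ p) ∧
    MemLp ϱ 2 ((timeMeasure T).prod m) ∧
    ∀ t ∈ Ioo 0 T, ∀ x y, |f t x y| ≤ ϱ (t, x) + M * |y|
  oneSidedLipschitz : ∃ lam : ℝ, ∀ t ∈ Ioo 0 T, ∀ x y y',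
    (f t x y - f t x y') * (y - y') ≤ lam * |y - y'| ^ 2

end ParabolicDirichlet

end

/-! Work in `X = L²(0,T;V)` and `Y = L²(0,T;H)`, with `ι : X → Y` the inclusion. The Riesz
isomorphism `V' → V` turns `∂_t` on `W₀` into an unbounded operator `L` in `X`. Hahn–Banach and
Riesz represent the functional `η ↦ (φ, η(T)) + ⟨⟨g, η⟩⟩` by a pair `p₀, q₀` in `X`
(`exists_representation`); its terminal part is bounded because of the energy inequality
`norm_sq_end_le`. The weak formulation then reads `L*(u - q₀) = p₀ - B u + ι* f(ι u)`, where `B` is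
the operator of the time-integrated form.

Three facts drive the proof. First, `L` and `L*` are both monotone (`timeDeriv_monotone`,
`timeDeriv_adjoint_monotone`). Both follow from regularizing in time by resolvents of the Volterra
operator `K u(t) = ∫₀ᵗ u`, which commutes with every bounded operator acting on `V` alone and
satisfies `⟪K u, u⟫ = ‖∫ u‖² / 2`. Second, `B` is coercive up to the norm of `H`, and `λ - f` is
monotone for some `λ ≥ 0`; replacing `u` by `exp((1 + λ) t) u` supplies both missing zero-order
terms (`shifted_equation_iff`). Third, `λ - f` acts on `Y` as a continuous monotone operator `N` of
linear growth for which every `1 + ε N` is onto, its resolvent being computed pointwise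
(`IsAdmissible.exists_operator`).

What remains is the abstract equation of `existsUnique_adjoint_equation`. Monotonicity of `L*`
applied to the difference of two solutions gives uniqueness. For existence, `1 + ε L*` is onto
because `L` is monotone, so the equation with a Lipschitz nonlinearity is a contraction problem. The
Yosida approximations of `N` are Lipschitz, and monotonicity makes the corresponding solutions a
Cauchy sequence, so no compactness is needed. -/

noncomputable section

namespace ParabolicDirichlet

/-! ### Abstract monotone equations involving the adjoint of a monotone operator -/

section MonotoneEquation

variable {W X Y : Type*} [AddCommGroup W] [Module ℝ W]
  [NormedAddCommGroup X] [InnerProductSpace ℝ X] [CompleteSpace X]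
  [NormedAddCommGroup Y] [InnerProductSpace ℝ Y] [CompleteSpace Y]

/-- If `p ↦ (a p, c p)` parametrizes the graph of a monotone linear operator, then the adjoint `L*`
of that operator has the property that `1 + ε L*` is onto. -/
theorem exists_adjoint_resolvent (a c : W →ₗ[ℝ] X) (hmon : ∀ p, 0 ≤ ⟪c p, a p⟫) {ε : ℝ}
    (hε : 0 < ε) (h : X) : ∃ x : X, ∀ p, ⟪c p, x⟫ = ⟪a p, ε⁻¹ • (h - x)⟫ := by
  set Φ : W →ₗ[ℝ] X := a + ε • c with hΦ
  have hΦp : ∀ p, Φ p = a p + ε • c p := fun p => rfl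
  have hle : ∀ p, ‖a p‖ ≤ ‖Φ p‖ := by
    intro p
    have h1 : ‖a p‖ * ‖a p‖ ≤ ‖Φ p‖ * ‖a p‖ := by
      refine le_trans ?_ (real_inner_le_norm (Φ p) (a p))
      rw [hΦp, inner_add_left, real_inner_smul_left, real_inner_self_eq_norm_mul_norm]
      nlinarith [hmon p]
    rcases (norm_nonneg (a p)).eq_or_lt with h0 | h0
    · rw [← h0]; exact norm_nonneg _
    · exact le_of_mul_le_mul_right h1 h0
  -- By `hle`, `a` vanishes on the kernel of `Φ`, so `Φ p ↦ a p` is a well-defined contraction on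
  -- the range. The section `s` expresses it linearly and `hsa` shows that the choice of `s` is
  -- immaterial. The functional `Φ p ↦ ⟪h, a p⟫` then extends to all of `X`, and its Riesz vector is
  -- the required `x`.
  obtain ⟨s, hs⟩ := Φ.rangeRestrict.exists_rightInverse_of_surjective Φ.range_rangeRestrict
  have hs' : ∀ y, Φ (s y) = y := fun y => by
    have := LinearMap.congr_fun hs y
    exact congrArg Subtype.val this
  have hsa : ∀ p, a (s (Φ.rangeRestrict p)) = a p := by
    intro p
    have h1 : ‖a (s (Φ.rangeRestrict p) - p)‖ ≤ 0 := by
      refine (hle _).trans ?_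
      rw [map_sub, hs']; simp
    have h2 := norm_le_zero_iff.mp h1
    rwa [map_sub, sub_eq_zero] at h2
  let ℓ : StrongDual ℝ (LinearMap.range Φ) :=
    (((innerSL ℝ h : X →L[ℝ] ℝ) : X →ₗ[ℝ] ℝ) ∘ₗ a ∘ₗ s).mkContinuous ‖h‖ (by
      intro y
      have h1 : ‖⟪h, a (s y)⟫‖ ≤ ‖h‖ * ‖a (s y)‖ := norm_inner_le_norm _ _
      have h2 := hle (s y)
      rw [hs'] at h2
      exact h1.trans (mul_le_mul_of_nonneg_left h2 (norm_nonneg _)))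
  obtain ⟨g, hg, -⟩ := exists_extension_norm_eq (LinearMap.range Φ) ℓ
  refine ⟨(InnerProductSpace.toDual ℝ X).symm g, fun p => ?_⟩
  have h1 : ⟪(InnerProductSpace.toDual ℝ X).symm g, Φ p⟫ = ⟪h, a p⟫ := by
    rw [InnerProductSpace.toDual_symm_apply]
    have h2 := hg (Φ.rangeRestrict p)
    have h3 : ℓ (Φ.rangeRestrict p) = ⟪h, a (s (Φ.rangeRestrict p))⟫ := rfl
    rw [h3, hsa] at h2
    exact h2
  set x := (InnerProductSpace.toDual ℝ X).symm g
  rw [hΦp, inner_add_right, real_inner_smul_right] at h1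
  rw [real_inner_smul_right, inner_sub_right, real_inner_comm x (c p), real_inner_comm h (a p),
    real_inner_comm x (a p)]
  field_simp
  linarith

/-- Solvability of `L* x + A x = 0` for `A` Lipschitz and strongly monotone, where `L` and `L*` are
monotone. -/
theorem exists_adjoint_add_lipschitz (a c : W →ₗ[ℝ] X) (hmon : ∀ p, 0 ≤ ⟪c p, a p⟫)
    (hadj : ∀ x b : X, (∀ p, ⟪c p, x⟫ = ⟪a p, b⟫) → 0 ≤ ⟪b, x⟫)
    {A : X → X} {K α : ℝ} (hα : 0 < α) (hL : ∀ x y, ‖A x - A y‖ ≤ K * ‖x - y‖)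
    (hA : ∀ x y, α * ‖x - y‖ ^ 2 ≤ ⟪A x - A y, x - y⟫) :
    ∃ x : X, ∀ p, ⟪c p, x⟫ = ⟪a p, -A x⟫ := by
  -- Enlarging the Lipschitz constant makes `1 - α² / K²` positive, so that its square root can
  -- serve as contraction factor.
  wlog hK : α < K generalizing K
  · refine this (K := max K (α + 1)) (fun x y => (hL x y).trans ?_)
      (lt_of_lt_of_le (by linarith) (le_max_right _ _))
    exact mul_le_mul_of_nonneg_right (le_max_left _ _) (norm_nonneg _)
  have hK0 : 0 < K := hα.trans hK
  -- This step size minimizes `1 - 2 ε α + ε² K²`, the bound for the squared Lipschitz constant of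
  -- `x ↦ x - ε A x`; the minimum is `1 - α² / K²`.
  set ε : ℝ := α / K ^ 2 with hεdef
  have hε : 0 < ε := by positivity
  choose J hJ using exists_adjoint_resolvent a c hmon hε
  -- `J` plays the role of `(1 + ε L*)⁻¹` and is nonexpansive because `L*` is monotone. Fixed points
  -- of `x ↦ J (x - ε A x)` are exactly what is sought.
  have hJle : ∀ h k, ‖J h - J k‖ ≤ ‖h - k‖ := by
    intro h k
    have h1 := hadj (J h - J k) (ε⁻¹ • (h - J h) - ε⁻¹ • (k - J k)) (fun p => by
      rw [inner_sub_right, inner_sub_right, hJ, hJ])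
    rw [← smul_sub, real_inner_smul_left] at h1
    have h2 : 0 ≤ ⟪h - J h - (k - J k), J h - J k⟫ :=
      nonneg_of_mul_nonneg_right h1 (by positivity)
    have h3 : h - J h - (k - J k) = (h - k) - (J h - J k) := by abel
    rw [h3, inner_sub_left, real_inner_self_eq_norm_mul_norm] at h2
    have h4 := real_inner_le_norm (h - k) (J h - J k)
    rcases (norm_nonneg (J h - J k)).eq_or_lt with h0 | h0
    · rw [← h0]; exact norm_nonneg _
    · exact le_of_mul_le_mul_right (by linarith) h0
  set q : ℝ := √(1 - α ^ 2 / K ^ 2) with hq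
  have hq0 : 0 ≤ 1 - α ^ 2 / K ^ 2 := by
    rw [sub_nonneg, div_le_one (by positivity)]; gcongr
  have hq1 : q < 1 := by
    rw [hq, Real.sqrt_lt' one_pos]
    have : 0 < α ^ 2 / K ^ 2 := by positivity
    linarith
  have hT : ∀ x y, ‖J (x - ε • A x) - J (y - ε • A y)‖ ≤ q * ‖x - y‖ := by
    intro x y
    refine (hJle _ _).trans ?_
    refine le_of_sq_le_sq ?_ (by positivity)
    rw [mul_pow, hq, Real.sq_sqrt hq0]
    have h3 : x - ε • A x - (y - ε • A y) = (x - y) - ε • (A x - A y) := by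
      rw [smul_sub]; abel
    rw [h3, norm_sub_sq_real, real_inner_smul_right, norm_smul, mul_pow, real_inner_comm,
      Real.norm_eq_abs, sq_abs]
    have h4 : ‖A x - A y‖ ^ 2 ≤ K ^ 2 * ‖x - y‖ ^ 2 := by
      rw [← mul_pow]; exact pow_le_pow_left₀ (norm_nonneg _) (hL x y) 2
    have h5 := hA x y
    have h6 : ε ^ 2 * ‖A x - A y‖ ^ 2 ≤ ε ^ 2 * (K ^ 2 * ‖x - y‖ ^ 2) := by gcongr
    have h7 : ε * (α * ‖x - y‖ ^ 2) ≤ ε * ⟪A x - A y, x - y⟫ := by gcongr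
    have h8 : ε ^ 2 * (K ^ 2 * ‖x - y‖ ^ 2) = α ^ 2 / K ^ 2 * ‖x - y‖ ^ 2 := by
      rw [hεdef]; field_simp
    have h9 : ε * (α * ‖x - y‖ ^ 2) = α ^ 2 / K ^ 2 * ‖x - y‖ ^ 2 := by
      rw [hεdef]; field_simp
    linarith
  have hc : ContractingWith ⟨q, Real.sqrt_nonneg _⟩ (fun x => J (x - ε • A x)) := by
    refine ⟨by exact_mod_cast hq1, LipschitzWith.of_dist_le_mul fun x y => ?_⟩
    rw [dist_eq_norm, dist_eq_norm]
    exact hT x y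
  have hfix : J (hc.fixedPoint - ε • A hc.fixedPoint) = hc.fixedPoint := hc.fixedPoint_isFixedPt
  refine ⟨hc.fixedPoint, fun p => ?_⟩
  have h1 := hJ (hc.fixedPoint - ε • A hc.fixedPoint) p
  rw [hfix] at h1
  rw [h1, sub_sub_cancel_left, smul_neg, smul_smul, inv_mul_cancel₀ hε.ne', one_smul]

/-- Resolvents of a monotone operator `N` for which all `1 + ε N` are onto: the Yosida
approximation `N ∘ J` is monotone, Lipschitz, and bounded by `N`. -/
theorem exists_yosida {Y : Type*} [NormedAddCommGroup Y] [InnerProductSpace ℝ Y] {N : Y → Y} (hN : ∀ y y', 0 ≤ ⟪N y - N y', y - y'⟫)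
    {ε : ℝ} (hε : 0 < ε) (hsurj : ∀ z, ∃ y, y + ε • N y = z) :
    ∃ J : Y → Y, (∀ z, J z + ε • N (J z) = z) ∧ (∀ z, ‖N (J z)‖ ≤ ‖N z‖) ∧
      (∀ z z', 0 ≤ ⟪N (J z) - N (J z'), z - z'⟫) ∧
      ∀ z z', ‖N (J z) - N (J z')‖ ≤ ε⁻¹ * ‖z - z'‖ := by
  choose J hJ using hsurj
  -- Cocoercivity: split `z - z'` by the resolvent identity; the part in `J z - J z'` contributes a
  -- nonnegative term. Monotonicity and the Lipschitz bound are both read off from this.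
  have hco : ∀ z z', ε * ‖N (J z) - N (J z')‖ ^ 2 ≤ ⟪N (J z) - N (J z'), z - z'⟫ := by
    intro z z'
    have h1 : z - z' = (J z - J z') + ε • (N (J z) - N (J z')) := by
      conv_lhs => rw [← hJ z, ← hJ z']
      rw [smul_sub]; abel
    rw [h1, inner_add_right, real_inner_smul_right, real_inner_self_eq_norm_sq]
    linarith [hN (J z) (J z')]
  refine ⟨J, hJ, fun z => ?_, fun z z' => le_trans (by positivity) (hco z z'), fun z z' => ?_⟩
  · have h1 := hN z (J z)
    have h2 : z - J z = ε • N (J z) := by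
      rw [sub_eq_iff_eq_add']; exact (hJ z).symm
    rw [h2, real_inner_smul_right] at h1
    have h3 := nonneg_of_mul_nonneg_right h1 hε
    rw [inner_sub_left, real_inner_self_eq_norm_mul_norm] at h3
    have h4 := real_inner_le_norm (N z) (N (J z))
    rcases (norm_nonneg (N (J z))).eq_or_lt with h0 | h0
    · rw [← h0]; exact norm_nonneg _
    · exact le_of_mul_le_mul_right (by linarith) h0
  · have h1 := (hco z z').trans (real_inner_le_norm _ _)
    rcases (norm_nonneg (N (J z) - N (J z'))).eq_or_lt with h0 | h0
    · rw [← h0]; positivity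
    · rw [inv_mul_eq_div, le_div_iff₀ hε]
      refine le_of_mul_le_mul_right ?_ h0
      nlinarith

/-- Uniqueness for `L* u + B u + ι* N ι u = 0` in variational form. -/
theorem adjoint_equation_unique (a c : W →ₗ[ℝ] X)
    (hadj : ∀ x b : X, (∀ p, ⟪c p, x⟫ = ⟪a p, b⟫) → 0 ≤ ⟪b, x⟫)
    (ι : X →L[ℝ] Y) (B : X →L[ℝ] X) {α : ℝ} (hα : 0 < α) (hB : ∀ x, α * ‖x‖ ^ 2 ≤ ⟪B x, x⟫)
    {N : Y → Y} (hN : ∀ y y', 0 ≤ ⟪N y - N y', y - y'⟫) (G : W → ℝ) {u u' : X}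
    (hu : ∀ p, ⟪c p, u⟫ + ⟪B u, a p⟫ + ⟪N (ι u), ι (a p)⟫ = G p)
    (hu' : ∀ p, ⟪c p, u'⟫ + ⟪B u', a p⟫ + ⟪N (ι u'), ι (a p)⟫ = G p) : u = u' := by
  -- The difference of two solutions lies in the domain of `L*`, with this image. Monotonicity of
  -- `L*` replaces the energy identity, for which a single solution would need a time derivative.
  have h1 := hadj (u - u') (-(B (u - u') + ι.adjoint (N (ι u) - N (ι u')))) (fun p => by
    have h2 := hu p
    have h3 := hu' p
    rw [inner_neg_right, inner_add_right, ContinuousLinearMap.adjoint_inner_right, map_sub,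
      inner_sub_right, inner_sub_right, inner_sub_right, real_inner_comm (B u),
      real_inner_comm (B u'), real_inner_comm (N (ι u)), real_inner_comm (N (ι u'))]
    linarith)
  rw [inner_neg_left, inner_add_left, ContinuousLinearMap.adjoint_inner_left, map_sub ι] at h1
  have h4 := hB (u - u')
  have h5 := hN (ι u) (ι u')
  have h6 : ‖u - u'‖ ^ 2 = 0 := le_antisymm (by nlinarith) (by positivity)
  exact sub_eq_zero.mp (norm_eq_zero.mp (pow_eq_zero_iff (by norm_num) |>.mp h6))

/-- Existence for the regularized equation, with bounds independent of the regularization. -/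
theorem exists_regularized_solution (a c : W →ₗ[ℝ] X) (hmon : ∀ p, 0 ≤ ⟪c p, a p⟫)
    (hadj : ∀ x b : X, (∀ p, ⟪c p, x⟫ = ⟪a p, b⟫) → 0 ≤ ⟪b, x⟫)
    (ι : X →L[ℝ] Y) (B : X →L[ℝ] X) {α : ℝ} (hα : 0 < α) (hB : ∀ x, α * ‖x‖ ^ 2 ≤ ⟪B x, x⟫)
    {N : Y → Y} (p₀ q₀ : X) {K : ℝ} (hL : ∀ y y', ‖N y - N y'‖ ≤ K * ‖y - y'‖)
    (hN : ∀ y y', 0 ≤ ⟪N y - N y', y - y'⟫) :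
    ∃ u : X, (∀ p, ⟪c p, u⟫ + ⟪B u, a p⟫ + ⟪N (ι u), ι (a p)⟫ = ⟪p₀, a p⟫ + ⟪q₀, c p⟫) ∧
      ‖u - q₀‖ ≤ α⁻¹ * (‖B q₀‖ + ‖ι‖ * ‖N (ι q₀)‖ + ‖p₀‖) := by
  -- Translating by `q₀` removes the term `⟪q₀, c p⟫`: the unknown is now `x = u - q₀`, which
  -- satisfies `L* x + A x = 0`.
  set A : X → X := fun x => B (x + q₀) + ι.adjoint (N (ι (x + q₀))) - p₀ with hAdef
  have hdiff : ∀ x y, A x - A y = B (x - y) + ι.adjoint (N (ι (x + q₀)) - N (ι (y + q₀))) := by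
    intro x y
    simp only [hAdef, map_add, map_sub]; abel
  have hK : ∀ y y', ‖N y - N y'‖ ≤ |K| * ‖y - y'‖ := fun y y' =>
    (hL y y').trans (mul_le_mul_of_nonneg_right (le_abs_self K) (norm_nonneg _))
  have hLA : ∀ x y, ‖A x - A y‖ ≤ (‖B‖ + ‖ι‖ * (|K| * ‖ι‖)) * ‖x - y‖ := by
    intro x y
    rw [hdiff, add_mul]
    refine (norm_add_le _ _).trans (add_le_add (B.le_opNorm _) ?_)
    refine (ι.adjoint.le_opNorm _).trans ?_
    rw [LinearIsometryEquiv.norm_map, mul_assoc]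
    refine mul_le_mul_of_nonneg_left ((hK _ _).trans ?_) (norm_nonneg _)
    rw [mul_assoc, ← map_sub, add_sub_add_right_eq_sub]
    exact mul_le_mul_of_nonneg_left (ι.le_opNorm _) (abs_nonneg _)
  have hSA : ∀ x y, α * ‖x - y‖ ^ 2 ≤ ⟪A x - A y, x - y⟫ := by
    intro x y
    rw [hdiff, inner_add_left, ContinuousLinearMap.adjoint_inner_left]
    have h1 := hN (ι (x + q₀)) (ι (y + q₀))
    rw [← map_sub, add_sub_add_right_eq_sub] at h1
    linarith [hB (x - y)]
  obtain ⟨x, hx⟩ := exists_adjoint_add_lipschitz a c hmon hadj hα hLA hSA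
  refine ⟨x + q₀, fun p => ?_, ?_⟩
  · have h1 := hx p
    rw [hAdef] at h1
    simp only [inner_neg_right, inner_sub_right, inner_add_right] at h1
    rw [ContinuousLinearMap.adjoint_inner_right] at h1
    rw [inner_add_right, h1, real_inner_comm (a p) (B _), real_inner_comm (ι (a p)),
      real_inner_comm (a p) p₀, real_inner_comm (c p) q₀]
    ring
  · rw [add_sub_cancel_right]
    have h1 := hadj x (-A x) hx
    have h2 := hSA x 0
    rw [sub_zero, inner_sub_left] at h2
    rw [inner_neg_left] at h1
    have h3 := abs_real_inner_le_norm (A 0) x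
    -- The nonlinearity enters only through its value at `ι q₀`, and not through `K`. This keeps the
    -- bound uniform along the Yosida approximations, whose Lipschitz constants blow up.
    have h4 : ‖A 0‖ ≤ ‖B q₀‖ + ‖ι‖ * ‖N (ι q₀)‖ + ‖p₀‖ := by
      simp only [hAdef, zero_add]
      refine (norm_sub_le _ _).trans (add_le_add_left ((norm_add_le _ _).trans
        (add_le_add_right ?_ _)) _)
      refine (ι.adjoint.le_opNorm _).trans ?_
      rw [LinearIsometryEquiv.norm_map]
    have h5 : α * ‖x‖ ^ 2 ≤ ‖A 0‖ * ‖x‖ := by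
      have := neg_abs_le ⟪A 0, x⟫
      linarith
    have h6 : α * ‖x‖ ≤ ‖A 0‖ := by
      rcases (norm_nonneg x).eq_or_lt with h0 | h0
      · rw [← h0]; simp
      · exact le_of_mul_le_mul_right (by nlinarith) h0
    rw [inv_mul_eq_div, le_div_iff₀ hα]
    linarith

/-- Existence and uniqueness for the variational equation `L* u + B u + ι* N ι u = p₀ + L* q₀`
with `L`, `L*` monotone, `B` coercive and `N` maximal monotone of linear growth. -/
theorem existsUnique_adjoint_equation (a c : W →ₗ[ℝ] X) (hmon : ∀ p, 0 ≤ ⟪c p, a p⟫)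
    (hadj : ∀ x b : X, (∀ p, ⟪c p, x⟫ = ⟪a p, b⟫) → 0 ≤ ⟪b, x⟫)
    (ι : X →L[ℝ] Y) (B : X →L[ℝ] X) {α : ℝ} (hα : 0 < α) (hB : ∀ x, α * ‖x‖ ^ 2 ≤ ⟪B x, x⟫)
    {N : Y → Y} (hNc : Continuous N) (hN : ∀ y y', 0 ≤ ⟪N y - N y', y - y'⟫)
    {C M : ℝ} (hM : 0 ≤ M) (hgrowth : ∀ y, ‖N y‖ ≤ C + M * ‖y‖)
    (hsurj : ∀ ε : ℝ, 0 < ε → ∀ z, ∃ y, y + ε • N y = z) (p₀ q₀ : X) :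
    ∃! u : X, ∀ p, ⟪c p, u⟫ + ⟪B u, a p⟫ + ⟪N (ι u), ι (a p)⟫ = ⟪p₀, a p⟫ + ⟪q₀, c p⟫ := by
  refine existsUnique_of_exists_of_unique ?_ fun u u' hu hu' =>
    adjoint_equation_unique a c hadj ι B hα hB hN _ hu hu'
  set ε : ℕ → ℝ := fun n => 1 / ((n : ℝ) + 1) with hεdef
  have hε : ∀ n, 0 < ε n := fun n => Nat.one_div_pos_of_nat
  have hε0 : Tendsto ε atTop (𝓝 0) := tendsto_one_div_add_atTop_nhds_zero_nat
  choose J hJ hJle hJmon hJlip using fun n => exists_yosida hN (hε n) (hsurj (ε n) (hε n))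
  choose u hu hub using fun n =>
    exists_regularized_solution a c hmon hadj ι B hα hB p₀ q₀ (hJlip n) (hJmon n)
  -- Yosida approximations are dominated by `N`. At `ι q₀` this bounds `u n` uniformly; the linear
  -- growth of `N` then bounds the regularized nonlinear terms.
  obtain ⟨C₁, hC₁⟩ : ∃ C₁, ∀ n, ‖N (J n (ι (u n)))‖ ≤ C₁ := by
    refine ⟨C + M * (‖ι‖ * (α⁻¹ * (‖B q₀‖ + ‖ι‖ * ‖N (ι q₀)‖ + ‖p₀‖) + ‖q₀‖)), fun n => ?_⟩
    refine (hJle n _).trans ((hgrowth _).trans ?_)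
    refine add_le_add_right (mul_le_mul_of_nonneg_left ?_ hM) _
    refine (ι.le_opNorm _).trans (mul_le_mul_of_nonneg_left ?_ (norm_nonneg _))
    have h1 : ‖u n‖ ≤ ‖u n - q₀‖ + ‖q₀‖ := by
      simpa using norm_add_le (u n - q₀) q₀
    refine h1.trans (add_le_add_left ((hub n).trans ?_) _)
    gcongr
    exact hJle n _
  have hC₁0 : 0 ≤ C₁ := (norm_nonneg _).trans (hC₁ 0)
  have hdist : ∀ n k, α * ‖u n - u k‖ ^ 2 ≤ 2 * C₁ ^ 2 * (ε n + ε k) := by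
    intro n k
    set y := N (J n (ι (u n))) with hy
    set z := N (J k (ι (u k))) with hz
    have h1 := hadj (u n - u k) (-(B (u n - u k) + ι.adjoint (y - z))) (fun p => by
      have h2 := hu n p
      have h3 := hu k p
      rw [← hy] at h2
      rw [← hz] at h3
      rw [inner_neg_right, inner_add_right, ContinuousLinearMap.adjoint_inner_right, map_sub,
        inner_sub_right, inner_sub_right, inner_sub_right, real_inner_comm (B (u n)),
        real_inner_comm (B (u k)), real_inner_comm y, real_inner_comm z]
      linarith)
    rw [inner_neg_left, inner_add_left, ContinuousLinearMap.adjoint_inner_left, map_sub ι] at h1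
    have h4 := hB (u n - u k)
    have h5 := hN (J n (ι (u n))) (J k (ι (u k)))
    rw [← hy, ← hz] at h5
    -- Monotonicity of `N` is available at the points `J n (ι (u n))`, not at `ι (u n)`. The
    -- discrepancy is of order `ε n + ε k`, since `y` and `z` are bounded by `C₁`.
    have h6 : ι (u n) - ι (u k) = (J n (ι (u n)) - J k (ι (u k))) + (ε n • y - ε k • z) := by
      conv_lhs => rw [← hJ n (ι (u n)), ← hJ k (ι (u k))]
      abel
    rw [h6, inner_add_right] at h1
    have h7 : |⟪y - z, ε n • y - ε k • z⟫| ≤ 2 * C₁ * ((ε n + ε k) * C₁) := by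
      refine (abs_real_inner_le_norm _ _).trans ?_
      have h8 : ‖y - z‖ ≤ 2 * C₁ := by
        have := norm_sub_le y z
        linarith [hC₁ n, hC₁ k]
      have h9 : ‖ε n • y - ε k • z‖ ≤ (ε n + ε k) * C₁ := by
        refine (norm_sub_le _ _).trans ?_
        rw [norm_smul, norm_smul, Real.norm_of_nonneg (hε n).le, Real.norm_of_nonneg (hε k).le,
          add_mul]
        exact add_le_add (mul_le_mul_of_nonneg_left (hC₁ n) (hε n).le)
          (mul_le_mul_of_nonneg_left (hC₁ k) (hε k).le)
      exact mul_le_mul h8 h9 (norm_nonneg _) (by positivity)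
    have := neg_abs_le ⟪y - z, ε n • y - ε k • z⟫
    nlinarith
  have hcauchy : CauchySeq u := by
    rw [Metric.cauchySeq_iff']
    intro δ hδ
    have h1 : Tendsto (fun n => 2 * C₁ ^ 2 * (ε n + ε n)) atTop (𝓝 (2 * C₁ ^ 2 * (0 + 0))) :=
      (hε0.add hε0).const_mul _
    simp only [add_zero, mul_zero] at h1
    obtain ⟨n₀, hn₀⟩ := (h1.eventually (gt_mem_nhds (show 0 < α * δ ^ 2 by positivity))).exists
    refine ⟨n₀, fun n hn => ?_⟩
    rw [dist_eq_norm]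
    have h2 := hdist n n₀
    have h3 : ε n ≤ ε n₀ := Nat.one_div_le_one_div hn
    have h4 : α * ‖u n - u n₀‖ ^ 2 < α * δ ^ 2 := by
      refine lt_of_le_of_lt (h2.trans ?_) hn₀
      gcongr
    exact lt_of_pow_lt_pow_left₀ 2 hδ.le (lt_of_mul_lt_mul_left h4 hα.le)
  obtain ⟨w, hw⟩ := cauchySeq_tendsto_of_complete hcauchy
  have hιw : Tendsto (fun n => ι (u n)) atTop (𝓝 (ι w)) := (ι.continuous.tendsto w).comp hw
  have hJw : Tendsto (fun n => J n (ι (u n))) atTop (𝓝 (ι w)) := by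
    have h1 : Tendsto (fun n => ε n • N (J n (ι (u n)))) atTop (𝓝 0) := by
      refine squeeze_zero_norm (a := fun n => ε n * C₁) (fun n => ?_) (by simpa using hε0.mul_const C₁)
      rw [norm_smul, Real.norm_of_nonneg (hε n).le]
      exact mul_le_mul_of_nonneg_left (hC₁ n) (hε n).le
    have h2 := hιw.sub h1
    rw [sub_zero] at h2
    refine h2.congr fun n => ?_
    rw [sub_eq_iff_eq_add]; exact (hJ n _).symm
  have hNw := (hNc.tendsto (ι w)).comp hJw
  refine ⟨w, fun p => ?_⟩
  have h1 : Tendsto (fun n => ⟪c p, u n⟫ + ⟪B (u n), a p⟫ + ⟪N (J n (ι (u n))), ι (a p)⟫) atTop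
      (𝓝 (⟪c p, w⟫ + ⟪B w, a p⟫ + ⟪N (ι w), ι (a p)⟫)) :=
    ((tendsto_const_nhds.inner hw).add
      (((B.continuous.tendsto w).comp hw).inner tendsto_const_nhds)).add
      (hNw.inner tendsto_const_nhds)
  refine tendsto_nhds_unique h1 ?_
  simp only [hu]
  exact tendsto_const_nhds

end MonotoneEquation

/-! ### Resolvents of bounded accretive operators -/

section AccretiveRegularization

variable {X : Type*} [NormedAddCommGroup X] [InnerProductSpace ℝ X] [CompleteSpace X]

/-- The resolvent `(h + K)⁻¹` of a bounded accretive operator. -/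
theorem exists_resolvent_of_accretive (K : X →L[ℝ] X) (hK : ∀ x, 0 ≤ ⟪K x, x⟫) {h : ℝ}
    (hh : 0 < h) : ∃ R : X → X, (∀ x, h • R x + K (R x) = x) ∧ ∀ x, h * ‖R x‖ ≤ ‖x‖ := by
  let b : X →L[ℝ] X →L[ℝ] ℝ := (innerSL ℝ).comp (h • ContinuousLinearMap.id ℝ X + K)
  have hb : ∀ x y, b x y = ⟪h • x + K x, y⟫ := fun x y => rfl
  -- Lax–Milgram for the form of `h + K`, which accretivity makes coercive with constant `h`.
  have hc : IsCoercive b := ⟨h, hh, fun x => by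
    rw [hb, inner_add_left, real_inner_smul_left, real_inner_self_eq_norm_mul_norm]
    linarith [hK x]⟩
  have h1 : ∀ x, hc.continuousLinearEquivOfBilin x = h • x + K x := fun x =>
    ext_inner_right ℝ fun y => by rw [hc.continuousLinearEquivOfBilin_apply, hb]
  have h2 : ∀ x, h • hc.continuousLinearEquivOfBilin.symm x
      + K (hc.continuousLinearEquivOfBilin.symm x) = x := fun x => by rw [← h1]; simp
  refine ⟨hc.continuousLinearEquivOfBilin.symm, h2, fun x => ?_⟩
  set r := hc.continuousLinearEquivOfBilin.symm x
  have h3 := real_inner_le_norm x r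
  conv_lhs at h3 => rw [← h2 x]
  rw [inner_add_left, real_inner_smul_left, real_inner_self_eq_norm_mul_norm] at h3
  rcases (norm_nonneg r).eq_or_lt with h0 | h0
  · rw [← h0]; simp
  · exact le_of_mul_le_mul_right (by linarith [hK r]) h0

/-- Accretivity makes `h + K` injective. Identities between resolvents can therefore be checked
after applying `h + K`; linearity and commutation relations are obtained in this way. -/
theorem eq_of_resolvent_eq {X : Type*} [NormedAddCommGroup X] [InnerProductSpace ℝ X]
    {K : X →L[ℝ] X} (hK : ∀ x, 0 ≤ ⟪K x, x⟫) {h : ℝ} (hh : 0 < h)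
    {w w' : X} (hw : h • w + K w = h • w' + K w') : w = w' := by
  have h1 : h • (w - w') + K (w - w') = 0 := by
    rw [smul_sub, map_sub, sub_add_sub_comm, hw, sub_self]
  have h2 : ⟪h • (w - w') + K (w - w'), w - w'⟫ = 0 := by rw [h1, inner_zero_left]
  rw [inner_add_left, real_inner_smul_left, real_inner_self_eq_norm_sq] at h2
  have h3 : ‖w - w'‖ ^ 2 ≤ 0 := by nlinarith [hK (w - w')]
  have h4 := le_antisymm h3 (by positivity)
  exact sub_eq_zero.mp (norm_eq_zero.mp (pow_eq_zero_iff (by norm_num) |>.mp h4))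

/-- For a bounded, accretive, injective operator `K` there are operators `Rₙ` with `K Rₙ → 1`
strongly. Every `Rₙ` is a resolvent `(hₙ + K)⁻¹`. -/
theorem exists_resolvent_approx (K : X →L[ℝ] X) (hK : ∀ x, 0 ≤ ⟪K x, x⟫)
    (hinj : ∀ x, K x = 0 → x = 0) :
    ∃ (h : ℕ → ℝ) (R : ℕ → X → X), (∀ n, 0 < h n) ∧ (∀ n x, h n • R n x + K (R n x) = x) ∧
      ∀ x, Tendsto (fun n => K (R n x)) atTop (𝓝 x) := by
  set h : ℕ → ℝ := fun n => 1 / ((n : ℝ) + 1) with hdef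
  have hh : ∀ n, 0 < h n := fun n => Nat.one_div_pos_of_nat
  have hh0 : Tendsto h atTop (𝓝 0) := tendsto_one_div_add_atTop_nhds_zero_nat
  choose R hR hRle using fun n => exists_resolvent_of_accretive K hK (hh n)
  refine ⟨h, R, hh, hR, fun x => ?_⟩
  have hRsub : ∀ n y z, R n (y - z) = R n y - R n z := fun n y z => by
    refine eq_of_resolvent_eq hK (hh n) ?_
    rw [hR, smul_sub, map_sub, sub_add_sub_comm, hR, hR]
  have hRK : ∀ n y, R n (K y) = K (R n y) := fun n y => by
    refine eq_of_resolvent_eq hK (hh n) ?_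
    rw [hR, ← map_smul, ← map_add, hR]
  -- For an accretive operator the kernel of the adjoint lies in the kernel of `K`: perturbing `y`
  -- in direction `w` leaves `s ⟪K y, w⟫ + s² ⟪K w, w⟫ ≥ 0` for all `s`, which for `w = -K y` and
  -- small `s > 0` forces `K y = 0`. Hence the range of `K` is dense.
  have hKer : ∀ y, (∀ w, ⟪K w, y⟫ = 0) → y = 0 := by
    intro y hy
    refine hinj y ?_
    have h1 : ∀ w, ∀ s : ℝ, 0 ≤ s * ⟪K y, w⟫ + s ^ 2 * ⟪K w, w⟫ := by
      intro w s
      have h2 := hK (y + s • w)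
      rw [map_add, map_smul, inner_add_left, inner_add_right, inner_add_right,
        real_inner_smul_left, real_inner_smul_left, real_inner_smul_right, real_inner_smul_right,
        hy y, hy w] at h2
      linarith
    have h3 := h1 (-K y)
    rw [inner_neg_right] at h3
    set A := ⟪K (-K y), -K y⟫
    by_contra hne
    have hpos : 0 < ⟪K y, K y⟫ := real_inner_self_pos.mpr hne
    have hA : 0 ≤ A := hK _
    have h4 := h3 (⟪K y, K y⟫ / (A + 1))
    have h6 : ⟪K y, K y⟫ / (A + 1) * A < ⟪K y, K y⟫ := by
      rw [div_mul_eq_mul_div, div_lt_iff₀ (by positivity)]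
      linarith
    have h7 : 0 < ⟪K y, K y⟫ / (A + 1) := by positivity
    nlinarith
  have hdense : Dense (LinearMap.range (K : X →ₗ[ℝ] X) : Set X) := by
    rw [Submodule.dense_iff_topologicalClosure_eq_top, Submodule.topologicalClosure_eq_top_iff, Submodule.eq_bot_iff]
    intro y hy
    exact hKer y fun w => (Submodule.mem_orthogonal _ y).mp hy (K w) ⟨w, rfl⟩
  rw [Metric.tendsto_atTop]
  intro δ hδ
  obtain ⟨z, ⟨y, hy⟩, hzx⟩ := Metric.mem_closure_iff.mp (hdense x) (δ / 2) (by positivity)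
  have hlim : Tendsto (fun n => h n * (2 * ‖y‖)) atTop (𝓝 0) := by
    simpa using hh0.mul_const (2 * ‖y‖)
  obtain ⟨n₀, hn₀⟩ := eventually_atTop.mp (hlim.eventually (gt_mem_nhds (half_pos hδ)))
  refine ⟨n₀, fun n hn => ?_⟩
  have hyz : K y = z := hy
  -- The error equals `h n • R n x`. Since `h n • R n` is a contraction, `x` may be replaced by a
  -- nearby `z = K y`, and there `R n (K y) = y - h n • R n y` is bounded in `n`.
  have h1 : x - K (R n x) = h n • R n (x - z) + h n • R n z := by
    rw [hRsub, smul_sub, sub_add_cancel, sub_eq_iff_eq_add, hR]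
  rw [dist_comm, dist_eq_norm, h1]
  have h2 : ‖h n • R n (x - z)‖ < δ / 2 := by
    rw [norm_smul, Real.norm_of_nonneg (hh n).le]
    refine (hRle n _).trans_lt ?_
    rwa [← dist_eq_norm]
  have h3 : ‖R n z‖ ≤ 2 * ‖y‖ := by
    have h4 : R n z = y - h n • R n y := by
      rw [← hyz, hRK, eq_sub_iff_add_eq']; exact hR n y
    rw [h4]
    refine (norm_sub_le _ _).trans ?_
    rw [norm_smul, Real.norm_of_nonneg (hh n).le]
    linarith [hRle n y]
  have h5 : ‖h n • R n z‖ < δ / 2 := by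
    rw [norm_smul, Real.norm_of_nonneg (hh n).le]
    exact (mul_le_mul_of_nonneg_left h3 (hh n).le).trans_lt (hn₀ n hn)
  linarith [norm_add_le (h n • R n (x - z)) (h n • R n z)]

end AccretiveRegularization

/-! ### Continuity of superposition operators in L² -/

section Superposition

variable {Ω F F' : Type*} [MeasurableSpace Ω] {μ : Measure Ω}
  [NormedAddCommGroup F] [NormedAddCommGroup F']

theorem Lp_norm_le_of_ae_le_add {r : Ω → ℝ} {M : ℝ} (hM : 0 ≤ M) (hr : MemLp r 2 μ)
    (x : Lp F' 2 μ) (d : Lp F 2 μ) (h : ∀ᵐ ξ ∂μ, ‖x ξ‖ ≤ r ξ + M * ‖d ξ‖) :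
    ‖x‖ ≤ ‖hr.toLp r‖ + M * ‖d‖ := by
  have hd : MemLp (fun ξ => ‖d ξ‖) 2 μ := (Lp.memLp d).norm
  have h1 : ‖hd.toLp _‖ ≤ ‖d‖ := by
    refine Lp.norm_le_norm_of_ae_le ?_
    filter_upwards [hd.coeFn_toLp] with ξ h1
    rw [h1, norm_norm]
  have h2 : ‖x‖ ≤ ‖hr.toLp r + M • hd.toLp _‖ := by
    refine Lp.norm_le_norm_of_ae_le ?_
    filter_upwards [h, hr.coeFn_toLp, hd.coeFn_toLp, Lp.coeFn_add (hr.toLp r) (M • hd.toLp _),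
      Lp.coeFn_smul M (hd.toLp _)] with ξ h1 h2 h3 h4 h5
    rw [h4, Pi.add_apply, h5, Pi.smul_apply, h2, h3, smul_eq_mul]
    exact h1.trans (le_abs_self _)
  refine h2.trans ((norm_add_le _ _).trans ?_)
  rw [norm_smul, Real.norm_of_nonneg hM]
  gcongr

theorem tendsto_toLp_zero_of_dominated {b : ℕ → Ω → ℝ} {s : Ω → ℝ} (hb : ∀ n, MemLp (b n) 2 μ)
    (hs : MemLp s 2 μ) (hle : ∀ n, ∀ᵐ ξ ∂μ, |b n ξ| ≤ s ξ)
    (hlim : ∀ᵐ ξ ∂μ, Tendsto (fun n => b n ξ) atTop (𝓝 0)) :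
    Tendsto (fun n => ‖(hb n).toLp (b n)‖) atTop (𝓝 0) := by
  have h1 : ∀ n, ‖(hb n).toLp (b n)‖ ^ 2 = ∫ ξ, b n ξ ^ 2 ∂μ := by
    intro n
    rw [← real_inner_self_eq_norm_sq, L2.inner_def]
    refine integral_congr_ae ?_
    filter_upwards [(hb n).coeFn_toLp] with ξ h1
    rw [h1, real_inner_self_eq_norm_sq, Real.norm_eq_abs, sq_abs]
  have h2 : Tendsto (fun n => ∫ ξ, b n ξ ^ 2 ∂μ) atTop (𝓝 (∫ _, (0 : ℝ) ∂μ)) := by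
    refine tendsto_integral_of_dominated_convergence (fun ξ => s ξ ^ 2)
      (fun n => (hb n).aestronglyMeasurable.pow 2) hs.integrable_sq (fun n => ?_) ?_
    · filter_upwards [hle n] with ξ h
      rw [Real.norm_eq_abs, abs_pow]
      exact pow_le_pow_left₀ (abs_nonneg _) h 2
    · filter_upwards [hlim] with ξ h
      simpa using h.pow 2
  rw [integral_zero] at h2
  have h3 : Tendsto (fun n => √(‖(hb n).toLp (b n)‖ ^ 2)) atTop (𝓝 (√0)) :=
    (Real.continuous_sqrt.tendsto 0).comp (by simpa only [h1] using h2)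
  simpa using h3

/-- `G` satisfies the Carathéodory and growth conditions that make `u ↦ G(·, u(·))` a continuous
operator in `L²`. -/
structure IsSuperposition (μ : Measure Ω) (G : Ω → F → F') : Prop where
  continuous : ∀ᵐ ξ ∂μ, Continuous (G ξ)
  measurable : ∀ u : Ω → F, AEStronglyMeasurable u μ →
    AEStronglyMeasurable (fun ξ => G ξ (u ξ)) μ
  growth : ∃ (r : Ω → ℝ) (M : ℝ), 0 ≤ M ∧ MemLp r 2 μ ∧ ∀ᵐ ξ ∂μ, ∀ y, ‖G ξ y‖ ≤ r ξ + M * ‖y‖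

namespace IsSuperposition

variable {G : Ω → F → F'}

theorem memLp (hG : IsSuperposition μ G) (u : Lp F 2 μ) : MemLp (fun ξ => G ξ (u ξ)) 2 μ := by
  obtain ⟨r, M, -, hr, hle⟩ := hG.growth
  refine (hr.add ((Lp.memLp u).norm.const_mul M)).mono
    (hG.measurable u (Lp.aestronglyMeasurable u)) ?_
  filter_upwards [hle] with ξ h
  exact (h _).trans (le_abs_self _)

/-- The superposition (Nemytskii) operator `u ↦ G(·, u(·))` in `L²`. -/
def op (hG : IsSuperposition μ G) (u : Lp F 2 μ) : Lp F' 2 μ := (hG.memLp u).toLp _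

theorem coeFn_op (hG : IsSuperposition μ G) (u : Lp F 2 μ) :
    hG.op u =ᵐ[μ] fun ξ => G ξ (u ξ) := (hG.memLp u).coeFn_toLp

theorem norm_op_le (hG : IsSuperposition μ G) {r : Ω → ℝ} {M : ℝ} (hM : 0 ≤ M)
    (hr : MemLp r 2 μ) (h : ∀ᵐ ξ ∂μ, ∀ y, ‖G ξ y‖ ≤ r ξ + M * ‖y‖) (u : Lp F 2 μ) :
    ‖hG.op u‖ ≤ ‖hr.toLp r‖ + M * ‖u‖ := by
  refine Lp_norm_le_of_ae_le_add hM hr _ _ ?_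
  filter_upwards [h, hG.coeFn_op u] with ξ h1 h2
  rw [h2]; exact h1 _

/-- An almost everywhere convergent subsequence need not come with a square integrable majorant.
Subtracting `M ‖w k - u‖` cures this: the positive part of `‖G(w k) - G(u)‖ - M ‖w k - u‖` is
dominated by `2 (r + M ‖u‖)` and tends to zero pointwise, while the subtracted term tends to zero in
`L²` by assumption. -/
theorem continuous_op (hG : IsSuperposition μ G) : Continuous hG.op := by
  obtain ⟨r, M, hM, hr, hle⟩ := hG.growth
  rw [continuous_iff_seqContinuous]
  intro v u hvu
  refine tendsto_of_subseq_tendsto fun ns hns => ?_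
  obtain ⟨ms, hms, hae⟩ :=
    (tendstoInMeasure_of_tendsto_Lp (hvu.comp hns)).exists_seq_tendsto_ae
  refine ⟨ms, ?_⟩
  have hw : Tendsto (fun k => v (ns (ms k))) atTop (𝓝 u) :=
    (hvu.comp hns).comp hms.tendsto_atTop
  set w : ℕ → Lp F 2 μ := fun k => v (ns (ms k)) with hwdef
  have hmem : ∀ k, MemLp (fun ξ => ‖hG.op (w k) ξ - hG.op u ξ‖ - M * ‖w k ξ - u ξ‖) 2 μ :=
    fun k => ((Lp.memLp _).sub (Lp.memLp _)).norm.sub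
      (((Lp.memLp _).sub (Lp.memLp _)).norm.const_mul M)
  have hmem' : ∀ k, MemLp
      (fun ξ => max (‖hG.op (w k) ξ - hG.op u ξ‖ - M * ‖w k ξ - u ξ‖) 0) 2 μ := by
    intro k
    refine (hmem k).mono ((hmem k).aestronglyMeasurable.sup aestronglyMeasurable_const)
      (Eventually.of_forall fun ξ => ?_)
    rw [Real.norm_eq_abs, Real.norm_eq_abs, abs_of_nonneg (le_max_right _ _)]
    exact max_le (le_abs_self _) (abs_nonneg _)
  have hs : MemLp (fun ξ => 2 * (r ξ + M * ‖u ξ‖)) 2 μ :=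
    (hr.add ((Lp.memLp u).norm.const_mul M)).const_mul 2
  have hb := tendsto_toLp_zero_of_dominated hmem' hs (fun k => by
      filter_upwards [hle, hG.coeFn_op (w k), hG.coeFn_op u] with ξ h1 h2 h3
      rw [abs_of_nonneg (le_max_right _ _), h2, h3]
      have h4 := norm_sub_le (G ξ (w k ξ)) (G ξ (u ξ))
      have h5 : ‖w k ξ‖ ≤ ‖w k ξ - u ξ‖ + ‖u ξ‖ := by
        simpa using norm_add_le (w k ξ - u ξ) (u ξ)
      have h6 := mul_le_mul_of_nonneg_left h5 hM
      have h7 := h1 (w k ξ)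
      have h8 := h1 (u ξ)
      have h9 := norm_nonneg (G ξ (u ξ))
      refine max_le (by linarith) (by linarith)) (by
      filter_upwards [hae, hG.continuous, ae_all_iff.mpr fun k => hG.coeFn_op (w k),
        hG.coeFn_op u] with ξ h1 h2 h3 h4
      have h5 : Tendsto (fun k => w k ξ) atTop (𝓝 (u ξ)) := h1
      have h6 : Tendsto (fun k => G ξ (w k ξ) - G ξ (u ξ)) atTop (𝓝 0) := by
        simpa using ((h2.tendsto _).comp h5).sub_const (G ξ (u ξ))
      have h7 : Tendsto (fun k => w k ξ - u ξ) atTop (𝓝 0) := by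
        simpa using h5.sub_const (u ξ)
      simp only [h3, h4]
      have h8 := ((h6.norm.sub (h7.norm.const_mul M)).max (tendsto_const_nhds (x := (0 : ℝ))))
      simpa using h8)
  rw [tendsto_iff_norm_sub_tendsto_zero]
  have hd : Tendsto (fun k => ‖w k - u‖) atTop (𝓝 0) :=
    tendsto_iff_norm_sub_tendsto_zero.mp hw
  refine squeeze_zero (fun _ => norm_nonneg _) (fun k => ?_)
    (by
      have h1 := hb.add (hd.const_mul M)
      rwa [mul_zero, add_zero] at h1)
  refine Lp_norm_le_of_ae_le_add hM (hmem' k) (hG.op (w k) - hG.op u) (w k - u) ?_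
  filter_upwards [Lp.coeFn_sub (hG.op (w k)) (hG.op u), Lp.coeFn_sub (w k) u] with ξ h1 h2
  rw [h1, h2, Pi.sub_apply, Pi.sub_apply]
  linarith [le_max_left (‖hG.op (w k) ξ - hG.op u ξ‖ - M * ‖w k ξ - u ξ‖) 0]

end IsSuperposition

end Superposition

/-! ### Measurability through distances -/

section StrongMeasurability

/-- A map into a separable metric space is measurable if all distances to fixed points are. -/
theorem measurable_of_measurable_dist {Ω S : Type*} [MeasurableSpace Ω] [PseudoMetricSpace S]
    [SecondCountableTopology S] [MeasurableSpace S] [BorelSpace S] {k : Ω → S}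
    (hk : ∀ s, Measurable fun ξ => dist (k ξ) s) : Measurable k := by
  refine measurable_of_isOpen fun U hU => ?_
  -- Lindelöf: an open set is a countable union of the balls it contains, and preimages of balls are
  -- sublevel sets of distance functions.
  obtain ⟨A, -, hA, hAU⟩ := TopologicalSpace.isOpen_biUnion_countable
    {p : S × ℝ | Metric.ball p.1 p.2 ⊆ U} (fun p => Metric.ball p.1 p.2)
    fun _ _ => Metric.isOpen_ball
  have h1 : U = ⋃ p ∈ A, Metric.ball p.1 p.2 := by
    rw [hAU]
    refine subset_antisymm (fun x hx => ?_) (iUnion₂_subset fun p hp => hp)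
    obtain ⟨ε, hε, h⟩ := Metric.isOpen_iff.mp hU x hx
    exact mem_iUnion₂.mpr ⟨(x, ε), h, Metric.mem_ball_self hε⟩
  rw [h1, preimage_iUnion₂]
  exact MeasurableSet.biUnion hA fun p _ => measurableSet_lt (hk p.1) measurable_const

end StrongMeasurability

theorem integrable_of_Lp_two {T : ℝ} {F : Type*} [NormedAddCommGroup F]
    (u : Lp F 2 (timeMeasure T)) : Integrable u (timeMeasure T) :=
  (Lp.memLp u).integrable (by norm_num)

/-! ### The Volterra operator, multiplication in time and the du Bois-Reymond lemma -/

section TimePrimitive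

variable {T : ℝ} {F F' : Type*} [NormedAddCommGroup F] [NormedSpace ℝ F]
  [NormedAddCommGroup F'] [NormedSpace ℝ F']

theorem exists_integral_norm_le (T : ℝ) : ∃ C : ℝ, 0 ≤ C ∧
    ∀ (F : Type _) [NormedAddCommGroup F] (u : Lp F 2 (timeMeasure T)),
      ∫ t, ‖u t‖ ∂(timeMeasure T) ≤ C * ‖u‖ := by
  refine ⟨(timeMeasure T univ ^ ((1 : ℝ) / 2)).toReal, ENNReal.toReal_nonneg, fun F _ u => ?_⟩
  have hfin : timeMeasure T univ ^ ((1 : ℝ) / 2) ≠ ⊤ :=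
    ENNReal.rpow_ne_top_of_nonneg (by norm_num) (measure_ne_top _ _)
  have h1 : eLpNorm u 1 (timeMeasure T)
      ≤ eLpNorm u 2 (timeMeasure T) * timeMeasure T univ ^ ((1 : ℝ) / 2) := by
    have h2 := eLpNorm_le_eLpNorm_mul_rpow_measure_univ (p := 1) (q := 2) (by norm_num)
      (Lp.aestronglyMeasurable u)
    convert h2 using 3
    norm_num
  have h3 : ∫ t, ‖u t‖ ∂(timeMeasure T) = (eLpNorm u 1 (timeMeasure T)).toReal := by
    rw [integral_norm_eq_lintegral_enorm (Lp.aestronglyMeasurable u), eLpNorm_one_eq_lintegral_enorm]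
  rw [h3, Lp.norm_def, mul_comm, ← ENNReal.toReal_mul]
  exact ENNReal.toReal_mono (ENNReal.mul_ne_top (Lp.memLp u).2.ne hfin) h1

/-- The primitive `t ↦ ∫₀ᵗ u(s) ds` of a function on `(0, T)`, extended by constants. -/
def primitive (T : ℝ) (u : ℝ → F) (t : ℝ) : F := ∫ s in (0 : ℝ)..t, u s ∂(timeMeasure T)

theorem primitive_zero_time (u : ℝ → F) : primitive T u 0 = 0 := intervalIntegral.integral_same

theorem continuous_primitive {u : ℝ → F} (hu : Integrable u (timeMeasure T)) :
    Continuous (primitive T u) :=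
  intervalIntegral.continuous_primitive (fun _ _ => hu.intervalIntegrable) 0

theorem primitive_congr {u v : ℝ → F} (h : u =ᵐ[timeMeasure T] v) (t : ℝ) :
    primitive T u t = primitive T v t :=
  intervalIntegral.integral_congr_ae (h.mono fun _ hs _ => hs)

theorem Ioc_inter_Ioo_ae_eq {t : ℝ} (ht : t ∈ Icc 0 T) :
    (Ioc 0 t ∩ Ioo 0 T : Set ℝ) =ᵐ[volume] Ioc 0 t := by
  have h1 : (Ioc 0 t ∩ Ioo 0 T : Set ℝ) =ᵐ[volume] (Ioc 0 t ∩ Ioc 0 T : Set ℝ) :=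
    (ae_eq_refl _).inter Ioo_ae_eq_Ioc
  rwa [inter_eq_left.mpr (Ioc_subset_Ioc_right ht.2)] at h1

theorem primitive_eq_intervalIntegral (u : ℝ → F) {t : ℝ} (ht : t ∈ Icc 0 T) :
    primitive T u t = ∫ s in (0 : ℝ)..t, u s := by
  rw [primitive, intervalIntegral.integral_of_le ht.1, intervalIntegral.integral_of_le ht.1,
    Measure.restrict_restrict measurableSet_Ioc]
  exact setIntegral_congr_set (Ioc_inter_Ioo_ae_eq ht)

theorem integral_timeMeasure_eq (hT : 0 ≤ T) (u : ℝ → F) :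
    ∫ t, u t ∂(timeMeasure T) = ∫ s in (0 : ℝ)..T, u s := by
  rw [intervalIntegral.integral_of_le hT]
  exact setIntegral_congr_set Ioo_ae_eq_Ioc

theorem primitive_end (hT : 0 ≤ T) (u : ℝ → F) :
    primitive T u T = ∫ t, u t ∂(timeMeasure T) := by
  rw [integral_timeMeasure_eq hT, primitive_eq_intervalIntegral u ⟨hT, le_rfl⟩]

theorem norm_primitive_le {u : ℝ → F} (hu : Integrable u (timeMeasure T)) (t : ℝ) :
    ‖primitive T u t‖ ≤ ∫ s, ‖u s‖ ∂(timeMeasure T) := by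
  refine (intervalIntegral.norm_integral_le_integral_norm_uIoc).trans ?_
  exact setIntegral_le_integral hu.norm (Eventually.of_forall fun _ => norm_nonneg _)

theorem memLp_primitive {u : ℝ → F} (hu : Integrable u (timeMeasure T)) :
    MemLp (primitive T u) 2 (timeMeasure T) :=
  MemLp.of_bound (continuous_primitive hu).aestronglyMeasurable _
    (Eventually.of_forall (norm_primitive_le hu))

theorem exists_primitive_bound (T : ℝ) (F : Type*) [NormedAddCommGroup F] [NormedSpace ℝ F] :
    ∃ C : ℝ, ∀ u : Lp F 2 (timeMeasure T),
      ‖(memLp_primitive (integrable_of_Lp_two u)).toLp _‖ ≤ C * ‖u‖ := by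
  obtain ⟨C, hC, hCle⟩ := exists_integral_norm_le T
  refine ⟨((timeMeasure T).real univ) ^ ((2 : ENNReal).toReal⁻¹) * C, fun u => ?_⟩
  rw [mul_assoc]
  refine Lp.norm_le_of_ae_bound (by positivity) ?_
  filter_upwards [(memLp_primitive (integrable_of_Lp_two u)).coeFn_toLp] with t ht
  rw [ht]
  exact (norm_primitive_le (integrable_of_Lp_two u) t).trans (hCle F u)

/-- The Volterra operator `u ↦ ∫₀ᵗ u(s) ds` on `L²(0, T; F)`. -/
def volterra (T : ℝ) (F : Type*) [NormedAddCommGroup F] [NormedSpace ℝ F] :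
    Lp F 2 (timeMeasure T) →L[ℝ] Lp F 2 (timeMeasure T) :=
  LinearMap.mkContinuousOfExistsBound
    { toFun := fun u => (memLp_primitive (integrable_of_Lp_two u)).toLp _
      map_add' := fun u v => by
        rw [← MemLp.toLp_add]
        refine MemLp.toLp_congr _ _ (Eventually.of_forall fun t => ?_)
        rw [primitive_congr (Lp.coeFn_add u v)]
        exact intervalIntegral.integral_add (integrable_of_Lp_two u).intervalIntegrable
          (integrable_of_Lp_two v).intervalIntegrable
      map_smul' := fun r u => by
        rw [RingHom.id_apply, ← MemLp.toLp_const_smul]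
        refine MemLp.toLp_congr _ _ (Eventually.of_forall fun t => ?_)
        rw [primitive_congr (Lp.coeFn_smul r u)]
        exact intervalIntegral.integral_smul r _ }
    (exists_primitive_bound T F)

theorem coeFn_volterra (u : Lp F 2 (timeMeasure T)) :
    volterra T F u =ᵐ[timeMeasure T] primitive T u :=
  (memLp_primitive (integrable_of_Lp_two u)).coeFn_toLp

theorem primitive_comp [CompleteSpace F] [CompleteSpace F'] (L : F →L[ℝ] F') {u : ℝ → F}
    (hu : Integrable u (timeMeasure T)) (t : ℝ) :
    primitive T (fun s => L (u s)) t = L (primitive T u t) :=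
  L.intervalIntegral_comp_comm hu.intervalIntegrable

theorem volterra_compLpL [CompleteSpace F] [CompleteSpace F'] (L : F →L[ℝ] F')
    (u : Lp F 2 (timeMeasure T)) :
    volterra T F' (L.compLpL 2 _ u) = L.compLpL 2 _ (volterra T F u) := by
  refine Lp.ext ?_
  filter_upwards [coeFn_volterra (L.compLpL 2 _ u), coeFn_volterra u,
    L.coeFn_compLpL (volterra T F u)] with t h1 h2 h3
  rw [h1, h3, h2, primitive_congr (L.coeFn_compLpL u), primitive_comp L (integrable_of_Lp_two u)]

/-- A closed property that holds for continuous functions holds on all of `L²(0, T; F)`. -/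
theorem Lp_time_induction {P : Lp F 2 (timeMeasure T) → Prop} (hP : IsClosed {u | P u})
    (h : ∀ (g : ℝ → F) (hg : MemLp g 2 (timeMeasure T)), Continuous g → P (hg.toLp g))
    (u : Lp F 2 (timeMeasure T)) : P u := by
  have hd := Lp.boundedContinuousFunction_dense F (timeMeasure T) (p := 2) (by norm_num)
  have h1 : (Lp.boundedContinuousFunction F 2 (timeMeasure T) : Set (Lp F 2 (timeMeasure T)))
      ⊆ {u | P u} := by
    intro v hv
    obtain ⟨g, hg⟩ := Lp.mem_boundedContinuousFunction_iff.mp hv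
    have h2 : (g : ℝ → F) =ᵐ[timeMeasure T] v := by
      have h3 := ContinuousMap.coeFn_toAEEqFun (timeMeasure T) g.toContinuousMap
      rw [hg] at h3
      exact h3.symm
    have h4 : MemLp g 2 (timeMeasure T) := (memLp_congr_ae h2).mpr (Lp.memLp v)
    have h5 : h4.toLp g = v := Lp.ext (h4.coeFn_toLp.trans h2)
    have h6 := h g h4 g.continuous
    rwa [h5] at h6
  exact hP.closure_subset_iff.mpr h1 (hd u)

theorem continuous_integral_time (T : ℝ) (F : Type*) [NormedAddCommGroup F] [NormedSpace ℝ F] :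
    Continuous fun u : Lp F 2 (timeMeasure T) => ∫ t, u t ∂(timeMeasure T) := by
  obtain ⟨C, hC, hCle⟩ := exists_integral_norm_le T
  let L : Lp F 2 (timeMeasure T) →ₗ[ℝ] F :=
    { toFun := fun u => ∫ t, u t ∂(timeMeasure T)
      map_add' := fun u v => by
        rw [integral_congr_ae (Lp.coeFn_add u v)]
        exact integral_add (integrable_of_Lp_two u) (integrable_of_Lp_two v)
      map_smul' := fun r u => by
        rw [integral_congr_ae (Lp.coeFn_smul r u)]
        exact integral_smul r _ }
  exact (L.mkContinuous C fun u =>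
    (norm_integral_le_integral_norm _).trans (hCle F u)).continuous

theorem exists_mul_bound {c : ℝ → ℝ} (hc : Continuous c) (T : ℝ) :
    ∃ C : ℝ, ∀ t ∈ Ioo 0 T, ‖c t‖ ≤ C := by
  obtain ⟨C, hC⟩ := (isCompact_Icc (a := (0 : ℝ)) (b := T)).exists_bound_of_continuousOn
    hc.continuousOn
  exact ⟨C, fun t ht => hC t (Ioo_subset_Icc_self ht)⟩

theorem memLp_continuous_smul {c : ℝ → ℝ} (hc : Continuous c) {u : ℝ → F}
    (hu : MemLp u 2 (timeMeasure T)) : MemLp (fun t => c t • u t) 2 (timeMeasure T) := by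
  obtain ⟨C, hC⟩ := exists_mul_bound hc T
  refine hu.of_le_mul (c := C) (hc.aestronglyMeasurable.smul hu.aestronglyMeasurable) ?_
  filter_upwards [ae_restrict_mem measurableSet_Ioo] with t ht
  rw [norm_smul]
  exact mul_le_mul_of_nonneg_right (hC t ht) (norm_nonneg _)

/-- Multiplication by a continuous scalar function on `L²(0, T; F)`. -/
def timeMul (T : ℝ) (F : Type*) [NormedAddCommGroup F] [NormedSpace ℝ F] (c : C(ℝ, ℝ)) :
    Lp F 2 (timeMeasure T) →L[ℝ] Lp F 2 (timeMeasure T) :=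
  LinearMap.mkContinuousOfExistsBound
    { toFun := fun u => (memLp_continuous_smul c.continuous (Lp.memLp u)).toLp _
      map_add' := fun u v => by
        rw [← MemLp.toLp_add]
        refine MemLp.toLp_congr _ _ ?_
        filter_upwards [Lp.coeFn_add u v] with t ht
        rw [ht, Pi.add_apply, smul_add, Pi.add_apply]
      map_smul' := fun r u => by
        rw [RingHom.id_apply, ← MemLp.toLp_const_smul]
        refine MemLp.toLp_congr _ _ ?_
        filter_upwards [Lp.coeFn_smul r u] with t ht
        rw [ht, Pi.smul_apply, smul_comm, Pi.smul_apply] }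
    (by
      obtain ⟨C, hC⟩ := exists_mul_bound c.continuous T
      refine ⟨C, fun u => Lp.norm_le_mul_norm_of_ae_le_mul ?_⟩
      filter_upwards [ae_restrict_mem measurableSet_Ioo,
        (memLp_continuous_smul c.continuous (Lp.memLp u)).coeFn_toLp] with t ht h1
      simp only [LinearMap.coe_mk, AddHom.coe_mk]
      rw [h1, norm_smul]
      exact mul_le_mul_of_nonneg_right (hC t ht) (norm_nonneg _))

theorem coeFn_timeMul (c : C(ℝ, ℝ)) (u : Lp F 2 (timeMeasure T)) :
    timeMul T F c u =ᵐ[timeMeasure T] fun t => c t • u t :=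
  (memLp_continuous_smul c.continuous (Lp.memLp u)).coeFn_toLp

theorem timeMul_compLpL (L : F →L[ℝ] F') (c : C(ℝ, ℝ)) (u : Lp F 2 (timeMeasure T)) :
    timeMul T F' c (L.compLpL 2 _ u) = L.compLpL 2 _ (timeMul T F c u) := by
  refine Lp.ext ?_
  filter_upwards [coeFn_timeMul c (L.compLpL 2 _ u), coeFn_timeMul c u, L.coeFn_compLpL u,
    L.coeFn_compLpL (timeMul T F c u)] with t h1 h2 h3 h4
  rw [h1, h4, h2, h3, map_smul]

theorem timeMul_timeMul_of_mul_eq_one {c d : C(ℝ, ℝ)} (h : ∀ t, c t * d t = 1)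
    (u : Lp F 2 (timeMeasure T)) : timeMul T F c (timeMul T F d u) = u := by
  refine Lp.ext ?_
  filter_upwards [coeFn_timeMul c (timeMul T F d u), coeFn_timeMul d u] with t h1 h2
  rw [h1, h2, smul_smul, h, one_smul]

/-- Both sides depend continuously on `u` in `L²`, so it is enough to integrate by parts for
continuous `u`, where the fundamental theorem of calculus applies. The boundary terms vanish because
the primitive is zero at `0` and `θ` is zero at `T`. -/
theorem integral_smul_primitive [CompleteSpace F] (hT : 0 ≤ T) {θ : ℝ → ℝ} (hθ : ContDiff ℝ ∞ θ)
    (ht : tsupport θ ⊆ Ioo 0 T) (u : Lp F 2 (timeMeasure T)) :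
    ∫ t in Ioo 0 T, deriv θ t • primitive T u t = - ∫ t in Ioo 0 T, θ t • u t := by
  have hd : Continuous (deriv θ) := hθ.continuous_deriv (by simp)
  have hc : ∀ u : Lp F 2 (timeMeasure T),
      (∫ t, timeMul T F ⟨deriv θ, hd⟩ (volterra T F u) t ∂(timeMeasure T)
        = - ∫ t, timeMul T F ⟨θ, hθ.continuous⟩ u t ∂(timeMeasure T)) ↔
      ∫ t in Ioo 0 T, deriv θ t • primitive T u t = - ∫ t in Ioo 0 T, θ t • u t := by
    intro u
    rw [integral_congr_ae (coeFn_timeMul _ u), integral_congr_ae (coeFn_timeMul _ _),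
      integral_congr_ae ((coeFn_volterra u).mono fun t h => by
        show (⟨deriv θ, hd⟩ : C(ℝ, ℝ)) t • volterra T F u t = deriv θ t • primitive T u t
        rw [h]; rfl)]
    rfl
  rw [← hc]
  refine Lp_time_induction (P := fun u : Lp F 2 (timeMeasure T) =>
    ∫ t, timeMul T F ⟨deriv θ, hd⟩ (volterra T F u) t ∂(timeMeasure T)
        = - ∫ t, timeMul T F ⟨θ, hθ.continuous⟩ u t ∂(timeMeasure T)) ?_ (fun g hg hgc => ?_) u
  · exact isClosed_eq ((continuous_integral_time T F).comp
      ((timeMul T F _).continuous.comp (volterra T F).continuous))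
      ((continuous_integral_time T F).comp (timeMul T F _).continuous).neg
  · rw [hc]
    have h1 : ∫ t in Ioo 0 T, deriv θ t • primitive T (hg.toLp g) t
        = ∫ t in Ioo 0 T, deriv θ t • ∫ s in (0 : ℝ)..t, g s := by
      refine setIntegral_congr_fun measurableSet_Ioo fun t ht => ?_
      show deriv θ t • primitive T (hg.toLp g) t = _
      rw [primitive_congr hg.coeFn_toLp, primitive_eq_intervalIntegral g (Ioo_subset_Icc_self ht)]
    have h2 : ∫ t in Ioo 0 T, θ t • (hg.toLp g) t = ∫ t in Ioo 0 T, θ t • g t :=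
      integral_congr_ae (hg.coeFn_toLp.mono fun t h => by simp only; rw [h])
    have hG : ∀ t, HasDerivAt (fun t => ∫ s in (0 : ℝ)..t, g s) (g t) t := fun t =>
      hgc.integral_hasStrictDerivAt 0 t |>.hasDerivAt
    have hGc : Continuous fun t => ∫ s in (0 : ℝ)..t, g s :=
      continuous_iff_continuousAt.mpr fun t => (hG t).continuousAt
    have hθ' : ∀ t, HasDerivAt θ (deriv θ t) t := fun t =>
      (hθ.differentiable (by simp) t).hasDerivAt
    have h3 : ∫ t in (0 : ℝ)..T, (θ t • g t + deriv θ t • ∫ s in (0 : ℝ)..t, g s)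
        = θ T • (∫ s in (0 : ℝ)..T, g s) - θ 0 • ∫ s in (0 : ℝ)..0, g s := by
      refine intervalIntegral.integral_eq_sub_of_hasDerivAt
        (f := fun t => θ t • ∫ s in (0 : ℝ)..t, g s) (fun t _ => (hθ' t).smul (hG t)) ?_
      exact ((hθ.continuous.smul hgc).add (hd.smul hGc)).intervalIntegrable _ _
    have h5 : ∫ t in (0 : ℝ)..T, (θ t • g t + deriv θ t • ∫ s in (0 : ℝ)..t, g s)
        = (∫ t in (0 : ℝ)..T, θ t • g t) + ∫ t in (0 : ℝ)..T, deriv θ t • ∫ s in (0 : ℝ)..t, g s :=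
      intervalIntegral.integral_add ((hθ.continuous.smul hgc).intervalIntegrable _ _)
        ((hd.smul hGc).intervalIntegrable _ _)
    have h4 : θ T = 0 := image_eq_zero_of_notMem_tsupport fun h => (ht h).2.false
    rw [h4, zero_smul, intervalIntegral.integral_same, smul_zero, sub_zero, h5, ← integral_timeMeasure_eq hT,
      ← integral_timeMeasure_eq hT] at h3
    rw [h1, h2]
    exact eq_neg_of_add_eq_zero_right h3

theorem ae_eq_zero_of_integral_test {g : ℝ → F} [CompleteSpace F]
    (hg : Integrable g (timeMeasure T))
    (h : ∀ θ : ℝ → ℝ, ContDiff ℝ ∞ θ → HasCompactSupport θ → tsupport θ ⊆ Ioo 0 T →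
      ∫ t in Ioo 0 T, θ t • g t = 0) : g =ᵐ[timeMeasure T] 0 := by
  have h1 := isOpen_Ioo.ae_eq_zero_of_integral_contDiff_smul_eq_zero
    (U := Ioo 0 T) (f := g) (μ := volume)
    (IntegrableOn.locallyIntegrableOn hg) (fun θ hθ hs ht => by
      rw [← h θ hθ hs ht, setIntegral_eq_integral_of_forall_compl_eq_zero]
      intro t htn
      rw [image_eq_zero_of_notMem_tsupport fun h => htn (ht h), zero_smul])
  exact (ae_restrict_iff' measurableSet_Ioo).mpr h1

theorem volterra_injective [CompleteSpace F] (hT : 0 ≤ T) (u : Lp F 2 (timeMeasure T))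
    (h : volterra T F u = 0) : u = 0 := by
  have h0 : primitive T u =ᵐ[timeMeasure T] 0 := by
    have h1 := coeFn_volterra u
    rw [h] at h1
    exact h1.symm.trans (Lp.coeFn_zero _ _ _)
  refine Lp.ext ((ae_eq_zero_of_integral_test (integrable_of_Lp_two u) ?_).trans
    (Lp.coeFn_zero _ _ _).symm)
  intro θ hθ _ ht
  rw [← neg_eq_zero, ← integral_smul_primitive hT hθ ht u]
  rw [integral_congr_ae (h0.mono fun t h => by
    show deriv θ t • primitive T u t = 0
    rw [h]; simp)]
  simp

/-- **du Bois-Reymond lemma.** A function whose distributional derivative on `(0, T)` vanishes is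
constant. -/
theorem ae_eq_const_of_integral_deriv_test [CompleteSpace F] (hT : 0 < T) {g : ℝ → F}
    (hg : Integrable g (timeMeasure T))
    (h : ∀ θ : ℝ → ℝ, ContDiff ℝ ∞ θ → HasCompactSupport θ → tsupport θ ⊆ Ioo 0 T →
      ∫ t in Ioo 0 T, deriv θ t • g t = 0) : ∃ c : F, ∀ᵐ t ∂(timeMeasure T), g t = c := by
  -- A bump of unit mass supported in `[T/4, 3T/4]`. If `g` is to be constant, its value must be `∫
  -- θ₀ g`.
  let b : ContDiffBump (T / 2) := ⟨T / 8, T / 4, by positivity, by linarith⟩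
  let θ₀ : ℝ → ℝ := b.normed volume
  have hθ₀ : ContDiff ℝ ∞ θ₀ := b.contDiff_normed
  have hs₀ : HasCompactSupport θ₀ := b.hasCompactSupport_normed
  have ht₀ : tsupport θ₀ ⊆ Ioo 0 T := by
    rw [b.tsupport_normed_eq, Real.closedBall_eq_Icc]
    intro t ht
    exact ⟨by linarith [ht.1, show T / 2 - T / 4 ≤ t from ht.1],
      by linarith [show t ≤ T / 2 + T / 4 from ht.2]⟩
  have hi₀ : ∫ t, θ₀ t = 1 := b.integral_normed
  set c : F := ∫ t in Ioo 0 T, θ₀ t • g t with hcdef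
  refine ⟨c, ?_⟩
  have hint : ∀ {ψ : ℝ → ℝ}, ContDiff ℝ ∞ ψ → Integrable (fun t => ψ t • g t) (timeMeasure T) := by
    intro ψ hψ
    obtain ⟨C, hC⟩ := exists_mul_bound hψ.continuous T
    exact hg.bdd_smul C hψ.continuous.aestronglyMeasurable
      ((ae_restrict_mem measurableSet_Ioo).mono hC)
  have h1 : (fun t => g t - c) =ᵐ[timeMeasure T] 0 := by
    refine ae_eq_zero_of_integral_test (hg.sub (integrable_const c)) fun ψ hψ hs ht => ?_
    set I : ℝ := ∫ t, ψ t with hI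
    -- Removing the mass of `ψ` makes `χ` the derivative of a test function: its primitive from `0`
    -- vanishes again beyond the support.
    set χ : ℝ → ℝ := fun t => ψ t - I * θ₀ t with hχ
    have hχc : ContDiff ℝ ∞ χ := hψ.sub (contDiff_const.mul hθ₀)
    have hχi : ∫ t, χ t = 0 := by
      rw [hχ, integral_sub (hψ.continuous.integrable_of_hasCompactSupport hs)
        ((hθ₀.continuous.integrable_of_hasCompactSupport hs₀).const_mul I),
        integral_const_mul, hi₀, mul_one, sub_self]
    obtain ⟨a, e, ha, he, hsub⟩ : ∃ a e, 0 < a ∧ e < T ∧ tsupport ψ ∪ tsupport θ₀ ⊆ Icc a e := by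
      have hne : (tsupport ψ ∪ tsupport θ₀).Nonempty := by
        refine Nonempty.inr ?_
        rw [b.tsupport_normed_eq]
        exact ⟨T / 2, Metric.mem_closedBall_self (by positivity)⟩
      have hcomp : IsCompact (tsupport ψ ∪ tsupport θ₀) := IsCompact.union hs hs₀
      have hsub := union_subset ht ht₀
      exact ⟨_, _, (hsub (hcomp.sInf_mem hne)).1, (hsub (hcomp.sSup_mem hne)).2, fun t h =>
        ⟨csInf_le hcomp.bddBelow h, le_csSup hcomp.bddAbove h⟩⟩
    have hχs : ∀ t, t ∉ Icc a e → χ t = 0 := by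
      intro t hn
      have h2 : ψ t = 0 := image_eq_zero_of_notMem_tsupport fun h => hn (hsub (Or.inl h))
      have h3 : θ₀ t = 0 := image_eq_zero_of_notMem_tsupport fun h => hn (hsub (Or.inr h))
      simp only [hχ, h2, h3, mul_zero, sub_zero]
    set θ : ℝ → ℝ := fun t => ∫ s in (0 : ℝ)..t, χ s with hθdef
    have hθd : ∀ t, HasDerivAt θ (χ t) t := fun t =>
      hχc.continuous.integral_hasStrictDerivAt 0 t |>.hasDerivAt
    have hθd' : deriv θ = χ := funext fun t => (hθd t).deriv
    have hθ : ContDiff ℝ ∞ θ := by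
      rw [contDiff_infty_iff_deriv]
      exact ⟨fun t => (hθd t).differentiableAt, hθd' ▸ hχc⟩
    have hθs : Function.support θ ⊆ Icc a e := by
      intro t htn
      by_contra hn
      apply htn
      rcases lt_or_ge t a with h2 | h2
      · refine (intervalIntegral.integral_congr (g := fun _ => (0 : ℝ)) fun s hs => ?_).trans
          (by simp)
        refine hχs s fun h3 => ?_
        have h4 : s ≤ max 0 t := hs.2
        exact absurd (h3.1.trans h4) (not_le.mpr (max_lt ha h2))
      · have h3 : e < t := not_le.mp fun h => hn ⟨h2, h⟩
        refine (intervalIntegral.integral_eq_integral_of_support_subset fun s hs => ?_).trans hχi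
        have h4 : s ∈ Icc a e := by
          by_contra h5; exact hs (hχs s h5)
        exact ⟨ha.trans_le h4.1, h4.2.trans h3.le⟩
    have hθt : tsupport θ ⊆ Icc a e := closure_minimal hθs isClosed_Icc
    have h2 := h θ hθ (isCompact_Icc.of_isClosed_subset (isClosed_tsupport θ) hθt)
      (hθt.trans fun t h => ⟨ha.trans_le h.1, h.2.trans_lt he⟩)
    rw [hθd'] at h2
    have h3 : ∫ t in Ioo 0 T, ψ t = I := by
      rw [setIntegral_eq_integral_of_forall_compl_eq_zero]
      exact fun t hn => image_eq_zero_of_notMem_tsupport fun h => hn (ht h)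
    have h4 : ∫ t in Ioo 0 T, χ t • g t = (∫ t in Ioo 0 T, ψ t • g t) - I • c := by
      have h6 : Integrable (fun t => I • θ₀ t • g t) (timeMeasure T) := (hint hθ₀).smul I
      rw [hcdef, ← integral_smul, ← integral_sub (hint hψ) h6]
      refine integral_congr_ae (Eventually.of_forall fun t => ?_)
      simp only [hχ, sub_smul, mul_smul]
    have h5 : ∫ t in Ioo 0 T, ψ t • (g t - c) = (∫ t in Ioo 0 T, ψ t • g t) - I • c := by
      rw [← h3, ← integral_smul_const, ← integral_sub (hint hψ)]
      · simp only [smul_sub]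
      · exact (((hψ.continuous.integrable_of_hasCompactSupport hs).restrict).smul_const c)
    rw [h5, ← h4, h2]
  filter_upwards [h1] with t h
  exact sub_eq_zero.mp h

end TimePrimitive

/-! ### The quadratic form of the Volterra operator -/

section TimeInner

variable {T : ℝ} {F : Type*} [NormedAddCommGroup F] [InnerProductSpace ℝ F]

theorem inner_timeMul (c : C(ℝ, ℝ)) (u v : Lp F 2 (timeMeasure T)) :
    ⟪timeMul T F c u, v⟫ = ⟪u, timeMul T F c v⟫ := by
  rw [L2.inner_def, L2.inner_def]
  refine integral_congr_ae ?_
  filter_upwards [coeFn_timeMul c u, coeFn_timeMul c v] with t h1 h2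
  rw [h1, h2, real_inner_smul_left, real_inner_smul_right]

/-- For continuous `u` with primitive `U` this integrates `d/dt ‖U‖² = 2 ⟪U, u⟫` over `(0, T)`;
density gives the rest. The identity serves both as accretivity of the Volterra operator and as the
source of the terminal value in the energy inequality. -/
theorem inner_volterra_self [CompleteSpace F] (hT : 0 ≤ T) (u : Lp F 2 (timeMeasure T)) :
    ⟪volterra T F u, u⟫ = ‖∫ t, u t ∂(timeMeasure T)‖ ^ 2 / 2 := by
  refine Lp_time_induction (P := fun u : Lp F 2 (timeMeasure T) =>
    ⟪volterra T F u, u⟫ = ‖∫ t, u t ∂(timeMeasure T)‖ ^ 2 / 2) ?_ (fun g hg hgc => ?_) u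
  · exact isClosed_eq ((volterra T F).continuous.inner continuous_id)
      (((continuous_integral_time T F).norm.pow 2).div_const 2)
  · have hG : ∀ t, HasDerivAt (fun t => ∫ s in (0 : ℝ)..t, g s) (g t) t := fun t =>
      hgc.integral_hasStrictDerivAt 0 t |>.hasDerivAt
    have hGc : Continuous fun t => ∫ s in (0 : ℝ)..t, g s :=
      continuous_iff_continuousAt.mpr fun t => (hG t).continuousAt
    have h1 : ⟪volterra T F (hg.toLp g), hg.toLp g⟫
        = ∫ t, ⟪∫ s in (0 : ℝ)..t, g s, g t⟫ ∂(timeMeasure T) := by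
      rw [L2.inner_def]
      refine integral_congr_ae ?_
      filter_upwards [coeFn_volterra (hg.toLp g), hg.coeFn_toLp,
        ae_restrict_mem measurableSet_Ioo] with t h2 h3 h4
      rw [h2, h3, primitive_congr hg.coeFn_toLp,
        primitive_eq_intervalIntegral g (Ioo_subset_Icc_self h4)]
    have h2 := intervalIntegral.integral_eq_sub_of_hasDerivAt (a := (0 : ℝ)) (b := T)
      (f := fun t => ‖∫ s in (0 : ℝ)..t, g s‖ ^ 2)
      (f' := fun t => 2 * ⟪∫ s in (0 : ℝ)..t, g s, g t⟫) (fun t _ => (hG t).norm_sq)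
      ((continuous_const.mul (hGc.inner hgc)).intervalIntegrable _ _)
    rw [intervalIntegral.integral_const_mul, ← integral_timeMeasure_eq hT, ← h1] at h2
    simp only [intervalIntegral.integral_same, norm_zero] at h2
    rw [integral_congr_ae hg.coeFn_toLp, integral_timeMeasure_eq hT]
    linarith

end TimeInner

/-! ### Monotonicity of the time derivative on `W₀` and of its adjoint -/

namespace FormFamily

variable {E : Type*} [MetricSpace E] [MeasurableSpace E] {m : Measure E} {T : ℝ}

theorem norm_sq_eq_shift (D : FormFamily m T) (φ : D.V) :
    ‖(show D.Dom from φ)‖ ^ 2 = shift (D.B 0) 1 φ φ := by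
  rw [D.norm_sq_eq, shift, one_mul]; rfl

instance (D : FormFamily m T) : CompleteSpace D.Dom := by
  refine Metric.complete_of_cauchySeq_tendsto fun s hs => ?_
  have hsub : ∀ φ ψ : D.Dom,
      ‖φ - ψ‖ ^ 2 = shift (D.B 0) 1 ((show D.V from φ) - (show D.V from ψ))
        ((show D.V from φ) - (show D.V from ψ)) := fun φ ψ => D.norm_sq_eq_shift _
  obtain ⟨φ, hφ⟩ := D.form_zero.closed s (fun ε hε => by
    obtain ⟨N, hN⟩ := Metric.cauchySeq_iff.mp hs (√ε) (Real.sqrt_pos.mpr hε)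
    refine ⟨N, fun n hn k hk => ?_⟩
    have h1 := hN n hn k hk
    rw [dist_eq_norm, Real.lt_sqrt (norm_nonneg _), hsub] at h1
    exact h1)
  have key : ∀ ψ : D.Dom, Tendsto (fun n => ‖s n - ψ‖ ^ 2) atTop (𝓝 0) →
      Tendsto s atTop (𝓝 ψ) := fun ψ h1 => by
    rw [tendsto_iff_norm_sub_tendsto_zero]
    have h2 := (Real.continuous_sqrt.tendsto 0).comp h1
    simpa [Function.comp_def] using h2
  exact ⟨φ, key φ (hφ.congr fun n => (hsub (s n) φ).symm)⟩

/-- The Riesz isomorphism `V' → V`. -/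
def riesz (D : FormFamily m T) : StrongDual ℝ D.Dom →L[ℝ] D.Dom :=
  LinearMap.mkContinuous
    { toFun := (InnerProductSpace.toDual ℝ D.Dom).symm
      map_add' := map_add _
      map_smul' := fun r ℓ => by simp } 1 fun ℓ => by simp

theorem inner_riesz (D : FormFamily m T) (ℓ : StrongDual ℝ D.Dom) (φ : D.Dom) :
    ⟪D.riesz ℓ, φ⟫ = ℓ φ := InnerProductSpace.toDual_symm_apply

/-- The embedding `H ≃ H' ⊂ V'`. -/
def dualOfH (D : FormFamily m T) : Lp ℝ 2 m →L[ℝ] StrongDual ℝ D.Dom :=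
  ((ContinuousLinearMap.compL ℝ D.Dom (Lp ℝ 2 m) ℝ).flip D.toH).comp (innerSL ℝ)

theorem dualOfH_apply (D : FormFamily m T) (y : Lp ℝ 2 m) (φ : D.Dom) :
    D.dualOfH y φ = ⟪y, D.toH φ⟫ := rfl

theorem toDual_eq (D : FormFamily m T) (φ : D.Dom) : D.toDual φ = D.dualOfH (D.toH φ) := rfl

/-- The operator `Q` on `V` with `⟪Q φ, ψ⟫_V = (φ, ψ)_H`. -/
def gram (D : FormFamily m T) : D.Dom →L[ℝ] D.Dom := D.riesz.comp D.toDual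

theorem inner_gram (D : FormFamily m T) (φ ψ : D.Dom) :
    ⟪D.gram φ, ψ⟫ = ⟪D.toH φ, D.toH ψ⟫ := D.inner_riesz _ _

theorem dense_range_toH (D : FormFamily m T) : DenseRange D.toH := by
  have h1 : range D.toH = (D.V : Set (Lp ℝ 2 m)) := Subtype.range_coe
  rw [DenseRange, h1]
  exact D.form_zero.dense_dom

/-- `L²(0, T; V) ⊂ L²(0, T; H)`. -/
abbrev toL2H (D : FormFamily m T) : D.L2V →L[ℝ] Lp (Lp ℝ 2 m) 2 (timeMeasure T) :=
  D.toH.compLpL 2 (timeMeasure T)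

theorem inner_gram_compLpL (D : FormFamily m T) (u w : D.L2V) :
    ⟪D.gram.compLpL 2 (timeMeasure T) u, w⟫ = ⟪D.toL2H u, D.toL2H w⟫ := by
  rw [L2.inner_def, L2.inner_def]
  refine integral_congr_ae ?_
  filter_upwards [D.gram.coeFn_compLpL u, D.toH.coeFn_compLpL u, D.toH.coeFn_compLpL w]
    with t h1 h2 h3
  rw [h1, h2, h3, inner_gram]

theorem inner_riesz_compLpL (D : FormFamily m T) (ζ : D.L2V') (u : D.L2V) :
    ⟪D.riesz.compLpL 2 (timeMeasure T) ζ, u⟫ = ∫ t in Ioo 0 T, ζ t (u t) := by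
  rw [L2.inner_def]
  refine integral_congr_ae ?_
  filter_upwards [D.riesz.coeFn_compLpL ζ] with t h1
  rw [h1, inner_riesz]

theorem riesz_toDual_compLpL (D : FormFamily m T) (u : D.L2V) :
    D.riesz.compLpL 2 (timeMeasure T) (D.toDual.compLpL 2 (timeMeasure T) u)
      = D.gram.compLpL 2 (timeMeasure T) u := by
  refine Lp.ext ?_
  filter_upwards [D.gram.coeFn_compLpL u, D.toDual.coeFn_compLpL u,
    D.riesz.coeFn_compLpL (D.toDual.compLpL 2 (timeMeasure T) u)] with t h1 h2 h3
  rw [h3, h1, h2]; rfl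

theorem volterra_accretive {F : Type*} [NormedAddCommGroup F] [InnerProductSpace ℝ F]
    [CompleteSpace F] (hT : 0 ≤ T) (u : Lp F 2 (timeMeasure T)) : 0 ≤ ⟪volterra T F u, u⟫ := by
  rw [inner_volterra_self hT]; positivity

/-- Primitives of `L²(0, T; V)` functions belong to `W₀`. -/
theorem volterra_mem_W0 (D : FormFamily m T) (w : D.L2V) :
    (volterra T D.Dom w, D.toDual.compLpL 2 (timeMeasure T) w) ∈ D.W0 := by
  refine ⟨fun θ hθ _ ht => ?_, fun t => D.toH (primitive T w t), ⟨?_, ?_⟩, ?_⟩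
  · rw [← integral_smul_primitive D.T_pos.le hθ ht]
    refine integral_congr_ae ?_
    filter_upwards [coeFn_volterra w] with t h1
    rw [h1, primitive_congr (D.toDual.coeFn_compLpL w), primitive_comp _ (integrable_of_Lp_two w)]
  · exact (D.toH.continuous.comp (continuous_primitive (integrable_of_Lp_two w))).continuousOn
  · filter_upwards [coeFn_volterra w] with t h1
    rw [h1]
  · show D.toH (primitive T w 0) = 0
    rw [primitive_zero_time, map_zero]

theorem ae_eq_extend_Icc {S : Type*} [TopologicalSpace S] [T2Space S] (hT : 0 < T) {v w : ℝ → S}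
    (h : v =ᵐ[timeMeasure T] w) (hv : ContinuousOn v (Icc 0 T)) (hw : ContinuousOn w (Icc 0 T)) :
    EqOn v w (Icc 0 T) := by
  refine Measure.eqOn_Icc_of_ae_eq volume hT.ne ?_ hv hw
  rwa [Measure.restrict_congr_set Ioo_ae_eq_Icc.symm]

/-- An element of `W₀` is the primitive, in `V'`, of its time derivative. -/
theorem primitive_of_mem_W0 (D : FormFamily m T) (p : D.W0) {v : ℝ → Lp ℝ 2 m}
    (hv : D.IsContVersion p.1.1 v) : ∀ t ∈ Icc 0 T, D.dualOfH (v t) = primitive T p.1.2 t := by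
  obtain ⟨⟨η, ζ⟩, hder, v₀, hv₀, hv₀0⟩ := p
  have hζ := integrable_of_Lp_two ζ
  have hζc := continuous_primitive hζ
  have hint : Integrable (fun t => D.toDual (η t) - primitive T ζ t) (timeMeasure T) :=
    ((D.memLp_toDual η).integrable (by norm_num)).sub
      ((memLp_primitive hζ).integrable (by norm_num))
  -- `η` and the primitive of `ζ` have the same distributional derivative, so they differ by a
  -- constant of `V'`; the initial condition identifies it as zero.
  obtain ⟨c, hc⟩ := ae_eq_const_of_integral_deriv_test D.T_pos hint (fun θ hθ hs ht => by
    have hd : Continuous (deriv θ) := hθ.continuous_deriv (by simp)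
    simp only [smul_sub]
    rw [integral_sub (integrable_smul hd hs.deriv (D.memLp_toDual η))
      (integrable_smul hd hs.deriv (memLp_primitive hζ)), hder θ hθ hs ht,
      integral_smul_primitive D.T_pos.le hθ ht, sub_self])
  have key : ∀ z, D.IsContVersion η z → ∀ t ∈ Icc 0 T, D.dualOfH (z t) = primitive T ζ t + c := by
    intro z hz
    refine ae_eq_extend_Icc D.T_pos ?_ (D.dualOfH.continuous.comp_continuousOn hz.1)
      (hζc.add continuous_const).continuousOn
    filter_upwards [hc, hz.2] with t h1 h2
    rw [h2, ← toDual_eq, ← h1]; abel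
  have hc0 : c = 0 := by
    have h1 := key v₀ hv₀ 0 ⟨le_rfl, D.T_pos.le⟩
    rwa [hv₀0, map_zero, primitive_zero_time, zero_add, eq_comm] at h1
  intro t ht
  rw [key v hv t ht, hc0, add_zero]

/-- This transports `η = ∫₀ᵗ ∂_t η`, an identity in `V'`, to `V` by the Riesz map. The relation `Q η
= K z` between bounded operators on `L²(0,T;V)` is then all that the energy inequality needs inside
the interval. -/
theorem gram_eq_volterra_of_mem_W0 (D : FormFamily m T) (p : D.W0) :
    D.gram.compLpL 2 (timeMeasure T) p.1.1
      = volterra T D.Dom (D.riesz.compLpL 2 (timeMeasure T) p.1.2) := by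
  obtain ⟨v, hv, -⟩ := p.2.2
  rw [volterra_compLpL, ← riesz_toDual_compLpL]
  congr 1
  refine Lp.ext ?_
  filter_upwards [coeFn_volterra p.1.2, D.toDual.coeFn_compLpL p.1.1, hv.2,
    ae_restrict_mem measurableSet_Ioo] with t h1 h2 h3 h4
  rw [h1, h2, ← D.primitive_of_mem_W0 p hv t (Ioo_subset_Icc_self h4), h3, toDual_eq]

/-- The energy inequality on `W₀`. -/
theorem norm_sq_end_le (D : FormFamily m T) (p : D.W0) {v : ℝ → Lp ℝ 2 m}
    (hv : D.IsContVersion p.1.1 v) :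
    ‖v T‖ ^ 2 ≤ 2 * ⟪D.riesz.compLpL 2 (timeMeasure T) p.1.2, p.1.1⟫ := by
  set η := p.1.1 with hη
  set z := D.riesz.compLpL 2 (timeMeasure T) p.1.2 with hz
  set K := volterra T D.Dom with hKdef
  set Q := D.gram.compLpL 2 (timeMeasure T) with hQ
  have hT := D.T_pos.le
  have hQη : Q η = K z := D.gram_eq_volterra_of_mem_W0 p
  have hK : ∀ x, 0 ≤ ⟪K x, x⟫ := volterra_accretive hT
  have hKQ : ∀ x, K (Q x) = Q (K x) := volterra_compLpL D.gram
  obtain ⟨h, R, hh, hR, hlim⟩ := exists_resolvent_approx K hK (volterra_injective hT)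
  -- `Q` acts in space and `K` in time, so they commute, and the relation `Q η = K z` passes to the
  -- regularizations. The function `K (R n η)` approximates `η` and has the derivative `R n η`,
  -- which takes values in `V`.
  have hRz : ∀ n, K (R n z) = Q (R n η) := by
    intro n
    refine eq_of_resolvent_eq hK (hh n) ?_
    rw [hKQ, ← map_smul Q, ← map_add Q, hR, hQη, ← map_smul K, ← map_add K, hR]
  set a : ℕ → Lp ℝ 2 m := fun n => ∫ t, D.toL2H (R n η) t ∂(timeMeasure T) with ha
  -- `a n` is the value in `H` at time `T` of the approximation `K (R n η)`, for which the energy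
  -- identity is the one for the Volterra operator.
  have hnorm : ∀ n, ‖a n‖ ^ 2 = 2 * ⟪K (R n z), K (R n η)⟫ := by
    intro n
    rw [hRz, hQ, inner_gram_compLpL, hKdef, ← volterra_compLpL, real_inner_comm,
      inner_volterra_self hT]
    ring
  have hlim' : Tendsto (fun n => ‖a n‖ ^ 2) atTop (𝓝 (2 * ⟪z, η⟫)) := by
    simp only [hnorm]
    exact ((hlim z).inner (hlim η)).const_mul 2
  -- The terminal values converge when tested against `V`, which is dense in `H`. Lower
  -- semicontinuity of the norm, in the form of the Cauchy–Schwarz bound `hle`, then gives the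
  -- inequality; strong convergence of `a n` is not needed.
  have hpair : ∀ φ : D.Dom, Tendsto (fun n => ⟪a n, D.toH φ⟫) atTop (𝓝 ⟪v T, D.toH φ⟫) := by
    intro φ
    have h1 : ∀ n, ⟪a n, D.toH φ⟫ = ⟪∫ t, K (R n z) t ∂(timeMeasure T), φ⟫ := by
      intro n
      show ⟪∫ t, D.toL2H (R n η) t ∂(timeMeasure T), D.toH φ⟫ = _
      rw [hRz, integral_congr_ae (D.toH.coeFn_compLpL (R n η)), hQ,
        integral_congr_ae (D.gram.coeFn_compLpL (R n η)),
        D.toH.integral_comp_comm (integrable_of_Lp_two _),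
        D.gram.integral_comp_comm (integrable_of_Lp_two _), inner_gram]
    have h2 : ⟪v T, D.toH φ⟫ = ⟪∫ t, z t ∂(timeMeasure T), φ⟫ := by
      rw [hz, integral_congr_ae (D.riesz.coeFn_compLpL p.1.2),
        D.riesz.integral_comp_comm (integrable_of_Lp_two _), inner_riesz, ← primitive_end hT,
        ← D.primitive_of_mem_W0 p hv T ⟨hT, le_rfl⟩, dualOfH_apply]
    simp only [h1, h2]
    exact (((continuous_integral_time T D.Dom).tendsto z).comp (hlim z)).inner tendsto_const_nhds
  have hle : ∀ y : Lp ℝ 2 m, ⟪v T, y⟫ ^ 2 ≤ 2 * ⟪z, η⟫ * ‖y‖ ^ 2 := by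
    intro y
    refine D.dense_range_toH.induction_on
      (p := fun y => ⟪v T, y⟫ ^ 2 ≤ 2 * ⟪z, η⟫ * ‖y‖ ^ 2) y ?_ fun φ => ?_
    · exact isClosed_le (by fun_prop) (by fun_prop)
    · refine le_of_tendsto_of_tendsto' ((hpair φ).pow 2) (hlim'.mul_const _) fun n => ?_
      rw [← mul_pow]
      refine sq_le_sq.mpr ((abs_real_inner_le_norm _ _).trans (le_abs_self _))
  have h0 : 0 ≤ 2 * ⟪z, η⟫ := ge_of_tendsto' hlim' fun n => by positivity
  have h1 := hle (v T)
  rw [real_inner_self_eq_norm_sq] at h1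
  rcases (norm_nonneg (v T)).eq_or_lt with h2 | h2
  · rw [← h2]; simpa using h0
  · have h3 : 0 < ‖v T‖ ^ 2 := by positivity
    exact le_of_mul_le_mul_right (by linarith) h3

/-- `∂_t` is monotone on `W₀`. -/
theorem timeDeriv_monotone (D : FormFamily m T) (p : D.W0) :
    0 ≤ ⟪D.riesz.compLpL 2 (timeMeasure T) p.1.2, p.1.1⟫ := by
  obtain ⟨v, hv, -⟩ := p.2.2
  have h1 := D.norm_sq_end_le p hv
  have h2 : 0 ≤ ‖v T‖ ^ 2 := by positivity
  linarith

/-- The adjoint of `∂_t` is monotone. -/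
theorem timeDeriv_adjoint_monotone (D : FormFamily m T) (x b : D.L2V)
    (h : ∀ p : D.W0, ⟪D.riesz.compLpL 2 (timeMeasure T) p.1.2, x⟫ = ⟪p.1.1, b⟫) : 0 ≤ ⟪b, x⟫ := by
  have hT := D.T_pos.le
  obtain ⟨k, R, hk, hR, hlim⟩ := exists_resolvent_approx (volterra T D.Dom)
    (volterra_accretive hT) (volterra_injective hT)
  have h1 : Tendsto (fun n => ⟪volterra T D.Dom (R n x), b⟫) atTop (𝓝 ⟪x, b⟫) :=
    (hlim x).inner tendsto_const_nhds
  rw [real_inner_comm]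
  refine ge_of_tendsto' h1 fun n => ?_
  -- Since `x` itself has no usable time regularity, the test function is `K (R n x)`, which tends
  -- to `x` and has derivative `R n x`. Writing `x = k n • R n x + K (R n x)` turns the other side
  -- into a sum of two nonnegative terms in `L²(0,T;H)`.
  have h2 := h ⟨_, D.volterra_mem_W0 (R n x)⟩
  simp only at h2
  rw [riesz_toDual_compLpL, inner_gram_compLpL] at h2
  rw [← h2]
  conv_rhs => rw [← hR n x]
  rw [map_add, map_smul, inner_add_right, real_inner_smul_right, ← volterra_compLpL, hR]
  have h3 := volterra_accretive hT (D.toL2H (R n x))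
  rw [real_inner_comm] at h3
  have h4 : 0 ≤ ⟪D.toL2H (R n x), D.toL2H (R n x)⟫ := real_inner_self_nonneg
  have h5 := hk n
  positivity

/-- The function `t ↦ exp (κ t)`. -/
def expMap (κ : ℝ) : C(ℝ, ℝ) := ⟨fun t => Real.exp (κ * t), by fun_prop⟩

theorem expMap_apply (κ t : ℝ) : expMap κ t = Real.exp (κ * t) := rfl

/-- `W₀` is stable under multiplication by `exp (κ t)`. -/
theorem timeMul_exp_mem_W0 (D : FormFamily m T) (κ : ℝ) (p : D.W0) :
    (timeMul T _ (expMap κ) p.1.1,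
      timeMul T _ (expMap κ) (p.1.2 + κ • D.toDual.compLpL 2 (timeMeasure T) p.1.1)) ∈ D.W0 := by
  obtain ⟨⟨η, ζ⟩, hder, v, hv, hv0⟩ := p
  refine ⟨fun θ hθ hs ht => ?_, fun t => expMap κ t • v t, ⟨?_, ?_⟩, ?_⟩
  · have he : ContDiff ℝ ∞ fun t => Real.exp (κ * t) := by fun_prop
    have hed : ∀ t, HasDerivAt (fun t => Real.exp (κ * t)) (κ * Real.exp (κ * t)) t := fun t => by
      simpa [mul_comm] using ((hasDerivAt_id t).const_mul κ).exp
    have hθe : ContDiff ℝ ∞ fun t => θ t * Real.exp (κ * t) := hθ.mul he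
    have hse : HasCompactSupport fun t => θ t * Real.exp (κ * t) := hs.mul_right
    -- The exponential is moved onto the scalar test function, so that the product rule is only
    -- needed for real functions.
    have hd := hder _ hθe hse ((tsupport_mul_subset_left).trans ht)
    have hdd : ∀ t, deriv (fun t => θ t * Real.exp (κ * t)) t
        = deriv θ t * Real.exp (κ * t) + θ t * (κ * Real.exp (κ * t)) := fun t =>
      ((hθ.differentiable (by simp) t).hasDerivAt.mul (hed t)).deriv
    have hdc : Continuous (deriv θ) := hθ.continuous_deriv (by simp)
    simp only [hdd, add_smul] at hd
    have i1 : Integrable (fun t => (deriv θ t * Real.exp (κ * t)) • D.toDual (η t))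
        (timeMeasure T) := integrable_smul (hdc.mul he.continuous) (hs.deriv.mul_right)
      (D.memLp_toDual η)
    have i2 : Integrable (fun t => (θ t * (κ * Real.exp (κ * t))) • D.toDual (η t))
        (timeMeasure T) :=
      integrable_smul (hθ.continuous.mul (continuous_const.mul he.continuous)) hs.mul_right
        (D.memLp_toDual η)
    have i3 : Integrable (fun t => (θ t * Real.exp (κ * t)) • ζ t) (timeMeasure T) :=
      integrable_smul hθe.continuous hse (Lp.memLp ζ)
    rw [integral_add i1 i2] at hd
    have e1 : ∫ t in Ioo 0 T, deriv θ t • D.toDual (timeMul T _ (expMap κ) η t)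
        = ∫ t in Ioo 0 T, (deriv θ t * Real.exp (κ * t)) • D.toDual (η t) := by
      refine integral_congr_ae ?_
      filter_upwards [coeFn_timeMul (expMap κ) η] with t h1
      rw [h1, map_smul, smul_smul, expMap_apply]
    have e2 : ∫ t in Ioo 0 T, θ t • timeMul T _ (expMap κ)
          (ζ + κ • D.toDual.compLpL 2 (timeMeasure T) η) t
        = (∫ t in Ioo 0 T, (θ t * Real.exp (κ * t)) • ζ t)
          + ∫ t in Ioo 0 T, (θ t * (κ * Real.exp (κ * t))) • D.toDual (η t) := by
      rw [← integral_add i3 i2]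
      refine integral_congr_ae ?_
      filter_upwards [coeFn_timeMul (expMap κ) (ζ + κ • D.toDual.compLpL 2 (timeMeasure T) η),
        Lp.coeFn_add ζ (κ • D.toDual.compLpL 2 (timeMeasure T) η),
        Lp.coeFn_smul κ (D.toDual.compLpL 2 (timeMeasure T) η), D.toDual.coeFn_compLpL η]
        with t h1 h2 h3 h4
      rw [h1, h2, Pi.add_apply, h3, Pi.smul_apply, h4, expMap_apply, smul_add, smul_add,
        smul_smul, smul_smul, smul_smul]
      congr 2
      ring
    show ∫ t in Ioo 0 T, deriv θ t • D.toDual (timeMul T _ (expMap κ) η t)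
      = -∫ t in Ioo 0 T, θ t • timeMul T _ (expMap κ)
          (ζ + κ • D.toDual.compLpL 2 (timeMeasure T) η) t
    rw [e1, e2, neg_add, ← hd]
    abel
  · exact (expMap κ).continuous.continuousOn.smul hv.1
  · filter_upwards [hv.2, coeFn_timeMul (expMap κ) η] with t h1 h2
    rw [h2, h1, map_smul]
  · show expMap κ 0 • v 0 = 0
    rw [hv0, smul_zero]

end FormFamily

/-! ### Strong measurability of Carathéodory compositions -/

section Caratheodory

variable {Ω F F' : Type*} [MeasurableSpace Ω] {μ : Measure Ω} [NormedAddCommGroup F']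

theorem aestronglyMeasurable_comp_simpleFunc {k : Ω → F → F'}
    (hk : ∀ c, AEStronglyMeasurable (fun s => k s c) μ) (u : SimpleFunc Ω F) :
    AEStronglyMeasurable (fun s => k s (u s)) μ := by
  classical
  have h1 : (fun s => k s (u s))
      = fun s => ∑ c ∈ u.range, (u ⁻¹' {c}).indicator (fun s => k s c) s := by
    funext s
    rw [Finset.sum_eq_single_of_mem (u s) (u.mem_range_self s)]
    · simp
    · intro c _ hc
      exact indicator_of_notMem (fun h => hc h.symm) _
  rw [h1]
  exact Finset.aestronglyMeasurable_fun_sum _ fun c _ =>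
    (hk c).indicator (u.measurableSet_preimage {c})

/-- Carathéodory functions preserve strong measurability. -/
theorem aestronglyMeasurable_comp_of_continuous [NormedAddCommGroup F] {k : Ω → F → F'}
    (hk : ∀ c, AEStronglyMeasurable (fun s => k s c) μ) (hc : ∀ᵐ s ∂μ, Continuous (k s))
    {u : Ω → F} (hu : AEStronglyMeasurable u μ) : AEStronglyMeasurable (fun s => k s (u s)) μ := by
  have hm := hu.stronglyMeasurable_mk
  refine aestronglyMeasurable_of_tendsto_ae atTop
    (fun n => aestronglyMeasurable_comp_simpleFunc hk (hm.approx n)) ?_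
  filter_upwards [hc, hu.ae_eq_mk] with s h1 h2
  rw [h2]
  exact (h1.tendsto _).comp (hm.tendsto_approx s)

end Caratheodory

/-! ### The time-dependent form as an operator on L²(0,T;V) -/

namespace FormFamily

variable {E : Type*} [MetricSpace E] [MeasurableSpace E] {m : Measure E} {T : ℝ}

theorem norm_toH_le (D : FormFamily m T) (φ : D.Dom) : ‖D.toH φ‖ ≤ ‖φ‖ := by
  have h := D.norm_incl_le φ
  rwa [one_mul] at h

/-- The sector condition and comparability with `B^{(0)}` bound `B^{(t)}₁` by `K c`, and removing
the `H`-product costs a further `1`. For the lower bound, `c⁻¹ ≤ 1` allows the factor `c⁻¹` to be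
put in front of the `H`-norm as well. -/
theorem exists_form_bounds (D : FormFamily m T) : ∃ C α : ℝ, 0 < α ∧ ∀ t ∈ Icc 0 T,
    (∀ φ ψ : D.Dom, |D.form t φ ψ| ≤ C * ‖φ‖ * ‖ψ‖) ∧
      ∀ φ : D.Dom, α * ‖φ‖ ^ 2 ≤ D.form t φ φ + ‖D.toH φ‖ ^ 2 := by
  obtain ⟨K, hK, hsec⟩ := D.sector
  obtain ⟨c, hc, hcomp⟩ := D.comparable
  have hc0 : 0 < c := by linarith
  refine ⟨K * c + 1, c⁻¹, inv_pos.mpr hc0, fun t ht => ?_⟩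
  have hsq : ∀ φ : D.Dom, ‖φ‖ ^ 2 = D.form 0 φ φ + ‖D.toH φ‖ ^ 2 := fun φ => by
    rw [D.norm_sq_eq, ← real_inner_self_eq_norm_sq]; rfl
  have hshift : ∀ φ : D.Dom, √(shift (D.B t) 1 φ φ) ≤ √c * ‖φ‖ := by
    intro φ
    rw [← Real.sqrt_sq (norm_nonneg φ), ← Real.sqrt_mul hc0.le]
    refine Real.sqrt_le_sqrt ?_
    have h1 : shift (D.B t) 1 φ φ = D.form t φ φ + ‖D.toH φ‖ ^ 2 := by
      rw [← real_inner_self_eq_norm_sq]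
      show D.form t φ φ + 1 * ⟪D.toH φ, D.toH φ⟫ = _
      rw [one_mul]
    have h2 : D.form t φ φ ≤ c * D.form 0 φ φ := (hcomp t ht φ).2
    rw [h1, hsq]
    nlinarith [sq_nonneg ‖D.toH φ‖]
  refine ⟨fun φ ψ => ?_, fun φ => ?_⟩
  · have h1 : D.form t φ ψ = shift (D.B t) 1 φ ψ - ⟪D.toH φ, D.toH ψ⟫ := by
      rw [eq_sub_iff_add_eq]
      show _ = D.form t φ ψ + 1 * ⟪D.toH φ, D.toH ψ⟫
      rw [one_mul]
    have h2 := hsec t ht φ ψ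
    have h3 : √(shift (D.B t) 1 φ φ) * √(shift (D.B t) 1 ψ ψ) ≤ c * (‖φ‖ * ‖ψ‖) := by
      refine (mul_le_mul (hshift φ) (hshift ψ) (Real.sqrt_nonneg _) (by positivity)).trans_eq ?_
      rw [mul_mul_mul_comm, Real.mul_self_sqrt hc0.le]
    have h4 : |⟪D.toH φ, D.toH ψ⟫| ≤ ‖φ‖ * ‖ψ‖ :=
      (abs_real_inner_le_norm _ _).trans
        (mul_le_mul (D.norm_toH_le φ) (D.norm_toH_le ψ) (norm_nonneg _) (norm_nonneg _))
    rw [h1]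
    refine (abs_sub _ _).trans ?_
    have h5 := mul_le_mul_of_nonneg_left h3 hK
    linarith
  · have h1 : c⁻¹ * D.form 0 φ φ ≤ D.form t φ φ := (hcomp t ht φ).1
    have h2 : c⁻¹ ≤ 1 := inv_le_one_of_one_le₀ hc
    rw [hsq]
    nlinarith [sq_nonneg ‖D.toH φ‖]

/-- The form is continuous in each argument for fixed `t`, so the Carathéodory argument is applied
twice, one argument at a time. -/
theorem aestronglyMeasurable_form (D : FormFamily m T) {u w : ℝ → D.Dom}
    (hu : AEStronglyMeasurable u (timeMeasure T)) (hw : AEStronglyMeasurable w (timeMeasure T)) :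
    AEStronglyMeasurable (fun t => D.form t (u t) (w t)) (timeMeasure T) := by
  obtain ⟨C, α, -, hC⟩ := D.exists_form_bounds
  have hmem : ∀ᵐ t ∂(timeMeasure T), t ∈ Icc 0 T :=
    (ae_restrict_mem measurableSet_Ioo).mono fun t ht => Ioo_subset_Icc_self ht
  have hbase : ∀ φ ψ : D.Dom, AEStronglyMeasurable (fun t => D.form t φ ψ) (timeMeasure T) :=
    fun φ ψ => ((D.measurable φ ψ).mono_measure
      (Measure.restrict_mono Ioo_subset_Icc_self le_rfl)).aestronglyMeasurable
  have h1 : ∀ ψ : D.Dom, AEStronglyMeasurable (fun t => D.form t (u t) ψ) (timeMeasure T) :=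
    fun ψ => aestronglyMeasurable_comp_of_continuous (k := fun t φ => D.form t φ ψ)
      (fun φ => hbase φ ψ) (hmem.mono fun t ht =>
        ((D.form t).flip ψ).mkContinuous (C * ‖ψ‖) (fun φ => by
          rw [Real.norm_eq_abs, mul_right_comm]; exact (hC t ht).1 φ ψ) |>.continuous) hu
  exact aestronglyMeasurable_comp_of_continuous (k := fun t ψ => D.form t (u t) ψ) h1
    (hmem.mono fun t ht => (D.form t (u t)).mkContinuous (C * ‖u t‖) (fun ψ => by
          rw [Real.norm_eq_abs]; exact (hC t ht).1 (u t) ψ) |>.continuous) hw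

theorem exists_form_integral_bound (D : FormFamily m T) : ∃ C : ℝ, ∀ u w : D.L2V,
    Integrable (fun t => D.form t (u t) (w t)) (timeMeasure T) ∧
      ‖∫ t in Ioo 0 T, D.form t (u t) (w t)‖ ≤ C * ‖u‖ * ‖w‖ := by
  obtain ⟨C, α, -, hC⟩ := D.exists_form_bounds
  refine ⟨|C|, fun u w => ?_⟩
  have hu : MemLp (fun t => ‖u t‖) 2 (timeMeasure T) := (Lp.memLp u).norm
  have hw : MemLp (fun t => ‖w t‖) 2 (timeMeasure T) := (Lp.memLp w).norm
  have hi : Integrable (fun t => ‖u t‖ * ‖w t‖) (timeMeasure T) := hu.integrable_mul hw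
  have hle : ∀ᵐ t ∂(timeMeasure T), ‖D.form t (u t) (w t)‖ ≤ |C| * (‖u t‖ * ‖w t‖) := by
    filter_upwards [ae_restrict_mem measurableSet_Ioo] with t ht
    refine ((hC t (Ioo_subset_Icc_self ht)).1 _ _).trans ?_
    rw [mul_assoc]
    exact mul_le_mul_of_nonneg_right (le_abs_self C) (by positivity)
  refine ⟨(hi.const_mul |C|).mono' (D.aestronglyMeasurable_form (Lp.aestronglyMeasurable u)
    (Lp.aestronglyMeasurable w)) hle, ?_⟩
  refine (norm_integral_le_of_norm_le (hi.const_mul |C|) hle).trans ?_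
  rw [integral_const_mul, mul_assoc]
  refine mul_le_mul_of_nonneg_left ?_ (abs_nonneg C)
  have h1 : ∫ t, ‖u t‖ * ‖w t‖ ∂(timeMeasure T) = ⟪hw.toLp _, hu.toLp _⟫ := by
    rw [L2.inner_def]
    refine integral_congr_ae ?_
    filter_upwards [hu.coeFn_toLp, hw.coeFn_toLp] with t h2 h3
    rw [h2, h3]; rfl
  rw [h1, mul_comm]
  refine (real_inner_le_norm _ _).trans_eq ?_
  rw [Lp.norm_toLp, Lp.norm_toLp, eLpNorm_norm, eLpNorm_norm, ← Lp.norm_def, ← Lp.norm_def]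

/-- The operator on `L²(0, T; V)` of the form `∫₀ᵀ B^{(t)}(u(t), w(t)) dt`. -/
theorem exists_formOp (D : FormFamily m T) : ∃ B : D.L2V →L[ℝ] D.L2V,
    (∀ u w, ⟪B u, w⟫ = ∫ t in Ioo 0 T, D.form t (u t) (w t)) ∧
      ∃ α : ℝ, 0 < α ∧ ∀ u, α * ‖u‖ ^ 2 ≤ ⟪B u, u⟫ + ‖D.toL2H u‖ ^ 2 := by
  obtain ⟨C, hC⟩ := D.exists_form_integral_bound
  let b : D.L2V →ₗ[ℝ] D.L2V →ₗ[ℝ] ℝ := LinearMap.mk₂ ℝ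
    (fun u w => ∫ t in Ioo 0 T, D.form t (u t) (w t))
    (fun u u' w => by
      rw [← integral_add (hC u w).1 (hC u' w).1]
      refine integral_congr_ae ?_
      filter_upwards [Lp.coeFn_add u u'] with t ht
      rw [ht, Pi.add_apply, map_add, LinearMap.add_apply])
    (fun r u w => by
      rw [← integral_smul]
      refine integral_congr_ae ?_
      filter_upwards [Lp.coeFn_smul r u] with t ht
      rw [ht, Pi.smul_apply, map_smul, LinearMap.smul_apply])
    (fun u w w' => by
      rw [← integral_add (hC u w).1 (hC u w').1]
      refine integral_congr_ae ?_
      filter_upwards [Lp.coeFn_add w w'] with t ht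
      rw [ht, Pi.add_apply, map_add])
    (fun r u w => by
      rw [← integral_smul]
      refine integral_congr_ae ?_
      filter_upwards [Lp.coeFn_smul r w] with t ht
      rw [ht, Pi.smul_apply, map_smul])
  let b' : D.L2V →L[ℝ] D.L2V →L[ℝ] ℝ := b.mkContinuous₂ C fun u w => (hC u w).2
  refine ⟨InnerProductSpace.continuousLinearMapOfBilin b', fun u w => ?_, ?_⟩
  · rw [InnerProductSpace.continuousLinearMapOfBilin_apply]; rfl
  · obtain ⟨C', α, hα, hle⟩ := D.exists_form_bounds
    refine ⟨α, hα, fun u => ?_⟩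
    have h1 : ⟪InnerProductSpace.continuousLinearMapOfBilin b' u, u⟫
        = ∫ t in Ioo 0 T, D.form t (u t) (u t) := by
      rw [InnerProductSpace.continuousLinearMapOfBilin_apply]; rfl
    rw [h1, ← real_inner_self_eq_norm_sq, ← real_inner_self_eq_norm_sq, L2.inner_def, L2.inner_def,
      ← integral_const_mul, ← integral_add (hC u u).1 (L2.integrable_inner _ _)]
    refine integral_mono_ae ((L2.integrable_inner _ _).const_mul α)
      ((hC u u).1.add (L2.integrable_inner _ _)) ?_
    filter_upwards [ae_restrict_mem measurableSet_Ioo, D.toH.coeFn_compLpL u] with t ht h2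
    show α * ⟪u t, u t⟫ ≤ D.form t (u t) (u t) + ⟪D.toL2H u t, D.toL2H u t⟫
    rw [h2, real_inner_self_eq_norm_sq, real_inner_self_eq_norm_sq]
    exact (hle t (Ioo_subset_Icc_self ht)).2 (u t)

end FormFamily

/-! ### The Nemytskii operator on L²(0,T;L²(E;m)) -/

section Nemytskii

variable {E : Type*} [MeasurableSpace E] {m : Measure E} {T : ℝ}

theorem norm_toLp_eq_sqrt {g : E → ℝ} (hg : MemLp g 2 m) :
    ‖hg.toLp g‖ = √(∫ x, g x ^ 2 ∂m) := by
  rw [eq_comm, Real.sqrt_eq_iff_mul_self_eq (integral_nonneg fun x => sq_nonneg _) (norm_nonneg _),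
    ← real_inner_self_eq_norm_mul_norm, L2.inner_def]
  refine integral_congr_ae ?_
  filter_upwards [hg.coeFn_toLp] with x h1
  rw [h1, real_inner_self_eq_norm_sq, Real.norm_eq_abs, sq_abs]

/-- Carathéodory functions of linear growth on `(0, T) × E × ℝ`. -/
structure IsCaratheodory (m : Measure E) (T : ℝ) (k : ℝ → E → ℝ → ℝ) : Prop where
  measurable : Measurable fun p : ℝ × E × ℝ => k p.1 p.2.1 p.2.2
  continuous : ∀ t x, Continuous (k t x)
  growth : ∃ (M : ℝ) (ϱ : ℝ × E → ℝ), 0 ≤ M ∧ MemLp ϱ 2 ((timeMeasure T).prod m) ∧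
    ∀ t ∈ Ioo 0 T, ∀ x y, |k t x y| ≤ ϱ (t, x) + M * |y|

/-- The slices of a square integrable function on a product. -/
theorem memLp_two_slices [SFinite m] {ϱ : ℝ × E → ℝ} (h : MemLp ϱ 2 ((timeMeasure T).prod m)) :
    (∀ᵐ t ∂(timeMeasure T), MemLp (fun x => ϱ (t, x)) 2 m) ∧
      MemLp (fun t => √(∫ x, ϱ (t, x) ^ 2 ∂m)) 2 (timeMeasure T) := by
  have h1 := h.integrable_sq
  constructor
  · filter_upwards [h.aestronglyMeasurable.prodMk_left, h1.prod_right_ae] with t h2 h3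
    exact (memLp_two_iff_integrable_sq h2).mpr h3
  · have h2 := h1.integral_prod_left
    rw [memLp_two_iff_integrable_sq (Real.continuous_sqrt.comp_aestronglyMeasurable
      h2.aestronglyMeasurable)]
    refine h2.congr (Eventually.of_forall fun t => ?_)
    exact (Real.sq_sqrt (integral_nonneg fun x => sq_nonneg _)).symm

theorem measurable_eLpNorm_slice [SFinite m] {g : ℝ × E → ℝ} (hg : Measurable g) :
    Measurable fun t => eLpNorm (fun x => g (t, x)) 2 m := by
  simp only [eLpNorm_eq_lintegral_rpow_enorm_toReal two_ne_zero ENNReal.ofNat_ne_top]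
  exact (Measurable.lintegral_prod_right' (hg.enorm.pow_const _)).pow_const _

/-- The distance of a slice to a fixed `s` is the `L²` seminorm of a slice of a jointly measurable
function, hence measurable in `t` by Tonelli. Separability of `L²(E;m)` upgrades this to strong
measurability. The value `0` covers slices that are not square integrable. -/
theorem measurable_toLp_slice [SFinite m] [SecondCountableTopology (Lp ℝ 2 m)]
    {g : ℝ × E → ℝ} (hg : Measurable g) {G : ℝ → Lp ℝ 2 m}
    (hG : ∀ t, eLpNorm (fun x => g (t, x)) 2 m < ⊤ → G t =ᵐ[m] fun x => g (t, x))
    (hG0 : ∀ t, ¬ eLpNorm (fun x => g (t, x)) 2 m < ⊤ → G t = 0) : StronglyMeasurable G := by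
  let _ : MeasurableSpace (Lp ℝ 2 m) := borel _
  have _ : BorelSpace (Lp ℝ 2 m) := ⟨rfl⟩
  refine Measurable.stronglyMeasurable (measurable_of_measurable_dist fun s => ?_)
  have hs : Measurable s := (Lp.stronglyMeasurable s).measurable
  have hA : MeasurableSet {t | eLpNorm (fun x => g (t, x)) 2 m < ⊤} :=
    measurableSet_lt (measurable_eLpNorm_slice hg) measurable_const
  have h1 : (fun t => dist (G t) s) = fun t =>
      {t | eLpNorm (fun x => g (t, x)) 2 m < ⊤}.piecewise
        (fun t => (eLpNorm (fun x => g (t, x) - s x) 2 m).toReal) (fun _ => dist 0 s) t := by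
    funext t
    by_cases ht : eLpNorm (fun x => g (t, x)) 2 m < ⊤
    · rw [piecewise_eq_of_mem _ _ _ (by exact ht), Lp.dist_def]
      congr 1
      refine eLpNorm_congr_ae ?_
      filter_upwards [hG t ht] with x hx
      rw [Pi.sub_apply, hx]
    · rw [piecewise_eq_of_notMem _ _ _ (by exact ht), hG0 t ht]
  rw [h1]
  exact Measurable.piecewise hA
    (measurable_eLpNorm_slice (hg.sub (hs.comp measurable_snd))).ennreal_toReal measurable_const

namespace IsCaratheodory

variable {k : ℝ → E → ℝ → ℝ}

theorem isSuperposition_slice [SFinite m] (hk : IsCaratheodory m T k) :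
    ∀ᵐ t ∂(timeMeasure T), IsSuperposition m (k t) := by
  obtain ⟨M, ϱ, hM, hϱ, hle⟩ := hk.growth
  filter_upwards [(memLp_two_slices hϱ).1, ae_restrict_mem measurableSet_Ioo] with t h1 h2
  refine ⟨Eventually.of_forall (hk.continuous t), fun u hu => ?_, _, M, hM, h1,
    Eventually.of_forall fun x y => hle t h2 x y⟩
  have h3 : AEMeasurable (fun x => (t, x, u x)) m :=
    aemeasurable_const.prodMk (aemeasurable_id.prodMk hu.aemeasurable)
  exact (hk.measurable.comp_aemeasurable h3).aestronglyMeasurable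

open Classical in
/-- The superposition operator of `k(t, ·, ·)` on `L²(E; m)`. -/
def slice (m : Measure E) (k : ℝ → E → ℝ → ℝ) (t : ℝ) (y : Lp ℝ 2 m) : Lp ℝ 2 m :=
  if h : IsSuperposition m (k t) then h.op y else 0

theorem slice_eq {t : ℝ} (h : IsSuperposition m (k t)) (y : Lp ℝ 2 m) :
    slice m k t y = h.op y := dif_pos h

/-- The superposition theory is used twice: in `x` for almost every `t`, producing a continuous map
of `L²(E;m)`, and then in `t` with these maps as Carathéodory function with values in `L²(E;m)`.
This avoids identifying the iterated space with `L²` of the product. -/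
theorem isSuperposition_time [SFinite m] [SecondCountableTopology (Lp ℝ 2 m)]
    (hk : IsCaratheodory m T k) : IsSuperposition (timeMeasure T) (slice m k) := by
  have hcont : ∀ᵐ t ∂(timeMeasure T), Continuous (slice m k t) := by
    filter_upwards [hk.isSuperposition_slice] with t h
    have h1 : slice m k t = h.op := funext (slice_eq h)
    rw [h1]
    exact h.continuous_op
  refine ⟨hcont, fun u hu => aestronglyMeasurable_comp_of_continuous (fun c => ?_) hcont hu, ?_⟩
  · classical
    have hc : Measurable c := (Lp.stronglyMeasurable c).measurable
    have hg : Measurable fun p : ℝ × E => k p.1 p.2 (c p.2) :=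
      hk.measurable.comp (measurable_fst.prodMk
        (measurable_snd.prodMk (hc.comp measurable_snd)))
    have hmem : ∀ t, eLpNorm (fun x => k t x (c x)) 2 m < ⊤ →
        MemLp (fun x => k t x (c x)) 2 m := fun t ht =>
      ⟨(hg.comp measurable_prodMk_left).aestronglyMeasurable, ht⟩
    have hs := measurable_toLp_slice (m := m) hg
      (G := fun t => if h : eLpNorm (fun x => k t x (c x)) 2 m < ⊤ then (hmem t h).toLp _ else 0)
      (fun t ht => by
        simp only
        rw [dif_pos ht]
        exact (hmem t ht).coeFn_toLp)
      (fun t ht => dif_neg ht)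
    refine hs.aestronglyMeasurable.congr ?_
    filter_upwards [hk.isSuperposition_slice] with t h
    rw [slice_eq h, dif_pos (h.memLp c).2]
    rfl
  · obtain ⟨M, ϱ, hM, hϱ, hle⟩ := hk.growth
    refine ⟨_, M, hM, (memLp_two_slices hϱ).2, ?_⟩
    filter_upwards [hk.isSuperposition_slice, (memLp_two_slices hϱ).1,
      ae_restrict_mem measurableSet_Ioo] with t h1 h2 h3 y
    rw [slice_eq h1, ← norm_toLp_eq_sqrt h2]
    exact h1.norm_op_le hM h2 (Eventually.of_forall fun x y => hle t h3 x y) y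

/-- The Nemytskii operator of a Carathéodory function on `L²(0, T; L²(E; m))`. -/
theorem exists_nemytskii [SFinite m] [SecondCountableTopology (Lp ℝ 2 m)]
    (hk : IsCaratheodory m T k) :
    ∃ N : Lp (Lp ℝ 2 m) 2 (timeMeasure T) → Lp (Lp ℝ 2 m) 2 (timeMeasure T),
      Continuous N ∧ (∃ C M : ℝ, 0 ≤ M ∧ ∀ u, ‖N u‖ ≤ C + M * ‖u‖) ∧
      ∀ u, ∀ᵐ t ∂(timeMeasure T), N u t =ᵐ[m] fun x => k t x (u t x) := by
  have h := hk.isSuperposition_time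
  obtain ⟨r, M, hM, hr, hle⟩ := h.growth
  refine ⟨h.op, h.continuous_op, ⟨_, M, hM, fun u => h.norm_op_le hM hr hle u⟩, fun u => ?_⟩
  filter_upwards [h.coeFn_op u, hk.isSuperposition_slice] with t h1 h2
  rw [h1, slice_eq h2]
  exact h2.coeFn_op (u t)

end IsCaratheodory

end Nemytskii

/-! ### Pointwise resolvents of monotone Carathéodory functions -/

section Resolvent

/-- A continuous function `Φ` with `(Φ y - Φ y') (y - y') ≥ |y - y'|²` is bijective. -/
theorem bijective_of_strongly_monotone {Φ : ℝ → ℝ} (hc : Continuous Φ)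
    (hΦ : ∀ y y', (y - y') ^ 2 ≤ (Φ y - Φ y') * (y - y')) : Function.Bijective Φ := by
  constructor
  · intro y y' h
    have h1 := hΦ y y'
    rw [h, sub_self, zero_mul] at h1
    exact sub_eq_zero.mp (pow_eq_zero_iff two_ne_zero |>.mp (le_antisymm h1 (sq_nonneg _)))
  · have hup : ∀ y, 0 ≤ y → Φ 0 + y ≤ Φ y := by
      intro y hy
      rcases hy.eq_or_lt with h | h
      · rw [← h]; simp
      · have h1 := hΦ y 0
        have h2 : y * y ≤ (Φ y - Φ 0) * y := by nlinarith
        linarith [le_of_mul_le_mul_right h2 h]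
    have hdown : ∀ y, 0 ≤ y → Φ (-y) ≤ Φ 0 - y := by
      intro y hy
      rcases hy.eq_or_lt with h | h
      · rw [← h]; simp
      · have h1 := hΦ (-y) 0
        have h2 : y * y ≤ (Φ 0 - Φ (-y)) * y := by nlinarith
        linarith [le_of_mul_le_mul_right h2 h]
    intro z
    refine mem_range_of_exists_le_of_exists_ge hc ⟨-|z - Φ 0|, ?_⟩ ⟨|z - Φ 0|, ?_⟩
    · have := hdown _ (abs_nonneg (z - Φ 0))
      linarith [neg_abs_le (z - Φ 0)]
    · have := hup _ (abs_nonneg (z - Φ 0))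
      linarith [le_abs_self (z - Φ 0)]

variable {E : Type*} [MeasurableSpace E] {m : Measure E} {T : ℝ}

/-- The resolvent of a monotone Carathéodory function is a Carathéodory function. -/
theorem IsCaratheodory.exists_resolvent {k : ℝ → E → ℝ → ℝ} (hk : IsCaratheodory m T k)
    (hmon : ∀ t x y y', 0 ≤ (k t x y - k t x y') * (y - y')) {ε : ℝ} (hε : 0 < ε) :
    ∃ j : ℝ → E → ℝ → ℝ, IsCaratheodory m T j ∧ ∀ t x z, j t x z + ε * k t x (j t x z) = z := by
  have hΦ : ∀ t x y y', (y - y') ^ 2 ≤ ((y + ε * k t x y) - (y' + ε * k t x y')) * (y - y') := by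
    intro t x y y'
    nlinarith [mul_nonneg hε.le (hmon t x y y')]
  have hbij := fun t x => bijective_of_strongly_monotone (Φ := fun y => y + ε * k t x y)
    (continuous_id.add (continuous_const.mul (hk.continuous t x))) (hΦ t x)
  choose j hj using fun t x z => (hbij t x).2 z
  have hj' : ∀ t x z, j t x z + ε * k t x (j t x z) = z := hj
  have hlip : ∀ t x z z', |j t x z - j t x z'| ≤ |z - z'| := by
    intro t x z z'
    have h1 := hΦ t x (j t x z) (j t x z')
    rw [hj', hj'] at h1
    rw [← sq_abs, pow_two] at h1
    have h2 : (z - z') * (j t x z - j t x z') ≤ |z - z'| * |j t x z - j t x z'| := by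
      rw [← abs_mul]; exact le_abs_self _
    rcases (abs_nonneg (j t x z - j t x z')).eq_or_lt with h0 | h0
    · rw [← h0]; exact abs_nonneg _
    · exact le_of_mul_le_mul_right (h1.trans h2) h0
  refine ⟨j, ⟨?_, fun t x => ?_, ?_⟩, hj'⟩
  · refine measurable_of_Ioi fun r => ?_
    -- As `y ↦ y + ε k(t, x, y)` is strictly increasing, superlevel sets of its inverse are
    -- described by `k` at the single level `r`; this yields joint measurability without a selection
    -- theorem.
    have h1 : (fun p : ℝ × E × ℝ => j p.1 p.2.1 p.2.2) ⁻¹' Ioi r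
        = {p : ℝ × E × ℝ | r + ε * k p.1 p.2.1 r < p.2.2} := by
      ext ⟨t, x, z⟩
      simp only [mem_preimage, mem_Ioi, mem_ofPred_eq]
      have h2 := hΦ t x (j t x z) r
      rw [hj'] at h2
      constructor
      · intro h
        have h3 : 0 < (j t x z - r) ^ 2 := by
          have : 0 < j t x z - r := sub_pos.mpr h
          positivity
        have h4 : 0 < z - (r + ε * k t x r) :=
          lt_of_mul_lt_mul_right (by rw [zero_mul]; exact h3.trans_le h2) (sub_pos.mpr h).le
        linarith
      · intro h
        by_contra hn
        have h3 : j t x z - r ≤ 0 := by linarith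
        have h4 : 0 < z - (r + ε * k t x r) := by linarith
        have h5 : (j t x z - r) ^ 2 ≤ 0 := h2.trans (mul_nonpos_of_nonneg_of_nonpos h4.le h3)
        have h6 : j t x z - r = 0 :=
          pow_eq_zero_iff two_ne_zero |>.mp (le_antisymm h5 (sq_nonneg _))
        have h7 : j t x z = r := by linarith
        have h8 := hj' t x z
        rw [h7] at h8
        linarith
    rw [h1]
    have h2 : Measurable fun p : ℝ × E × ℝ => k p.1 p.2.1 r :=
      hk.measurable.comp (measurable_fst.prodMk
        ((measurable_fst.comp measurable_snd).prodMk measurable_const))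
    exact measurableSet_lt ((h2.const_mul ε).const_add r) (measurable_snd.comp measurable_snd)
  · refine (LipschitzWith.of_dist_le_mul (K := 1) fun z z' => ?_).continuous
    rw [NNReal.coe_one, one_mul, Real.dist_eq, Real.dist_eq]
    exact hlip t x z z'
  · obtain ⟨M, ϱ, hM, hϱ, hle⟩ := hk.growth
    refine ⟨1, fun p => ε * ϱ p, zero_le_one, hϱ.const_mul ε, fun t ht x z => ?_⟩
    -- The growth bound comes from nonexpansiveness, comparing `z` with the point `ε k(t, x, 0)`
    -- that the resolvent sends to zero.
    have h1 : j t x (0 + ε * k t x 0) = 0 := (hbij t x).1 (hj t x _)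
    have h2 := hlip t x z (0 + ε * k t x 0)
    rw [h1, sub_zero, zero_add] at h2
    have h3 := hle t ht x 0
    rw [abs_zero, mul_zero, add_zero] at h3
    have h4 : |z - ε * k t x 0| ≤ |z| + |ε * k t x 0| := abs_sub _ _
    rw [abs_mul, abs_of_pos hε] at h4
    have h5 := mul_le_mul_of_nonneg_left h3 hε.le
    linarith

end Resolvent

/-! ### The nonlinearity f as an operator -/

section Nonlinearity

variable {E : Type*} {T : ℝ}

open Classical in
/-- The extension of `f` by zero from `(0, T)` to the line. -/
def zeroExtend (T : ℝ) (f : ℝ → E → ℝ → ℝ) (t : ℝ) (x : E) (y : ℝ) : ℝ :=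
  if t ∈ Ioo 0 T then f t x y else 0

theorem zeroExtend_of_mem {f : ℝ → E → ℝ → ℝ} {t : ℝ} (ht : t ∈ Ioo 0 T) (x : E) (y : ℝ) :
    zeroExtend T f t x y = f t x y := if_pos ht

theorem zeroExtend_of_notMem {f : ℝ → E → ℝ → ℝ} {t : ℝ} (ht : t ∉ Ioo 0 T) (x : E) (y : ℝ) :
    zeroExtend T f t x y = 0 := if_neg ht

theorem continuous_zeroExtend {f : ℝ → E → ℝ → ℝ} (hf : ∀ t ∈ Ioo 0 T, ∀ x, Continuous (f t x))
    (t : ℝ) (x : E) : Continuous (zeroExtend T f t x) := by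
  by_cases ht : t ∈ Ioo 0 T
  · exact (hf t ht x).congr fun y => (zeroExtend_of_mem ht x y).symm
  · exact continuous_const.congr fun y => (zeroExtend_of_notMem ht x y).symm

variable [MeasurableSpace E] {m : Measure E}

theorem measurable_zeroExtend {f : ℝ → E → ℝ → ℝ}
    (hf : Measurable fun p : Ioo (0 : ℝ) T × E × ℝ => f p.1 p.2.1 p.2.2) :
    Measurable fun p : ℝ × E × ℝ => zeroExtend T f p.1 p.2.1 p.2.2 := by
  have hs : MeasurableSet {p : ℝ × E × ℝ | p.1 ∈ Ioo 0 T} := measurable_fst measurableSet_Ioo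
  refine measurable_of_restrict_of_restrict_compl hs ?_ ?_
  · have h1 : Measurable fun p : {p : ℝ × E × ℝ | p.1 ∈ Ioo 0 T} =>
        ((⟨p.1.1, p.2⟩, p.1.2) : Ioo (0 : ℝ) T × E × ℝ) :=
      ((measurable_fst.comp measurable_subtype_coe).subtype_mk).prodMk
        (measurable_snd.comp measurable_subtype_coe)
    convert hf.comp h1 using 1
    funext p
    exact zeroExtend_of_mem p.2 _ _
  · convert measurable_const (a := (0 : ℝ)) using 1
    funext p
    exact zeroExtend_of_notMem p.2 _ _

theorem IsAdmissible.isCaratheodory {f : ℝ → E → ℝ → ℝ} (hf : IsAdmissible m T f) :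
    IsCaratheodory m T (zeroExtend T f) := by
  obtain ⟨M, ϱ, hM, -, hϱ, hle⟩ := hf.growth
  exact ⟨measurable_zeroExtend hf.measurable, continuous_zeroExtend hf.continuous, M, ϱ, hM, hϱ,
    fun t ht x y => by rw [zeroExtend_of_mem ht]; exact hle t ht x y⟩

/-- The superposition operator `u ↦ f(·, u)` on `L²(0, T; L²(E; m))`: it is continuous, of linear
growth, and `λ - f` is maximal monotone for some `λ ≥ 0`. -/
theorem IsAdmissible.exists_operator [SFinite m] [SecondCountableTopology (Lp ℝ 2 m)]
    {f : ℝ → E → ℝ → ℝ} (hf : IsAdmissible m T f) :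
    ∃ (lam : ℝ) (N : Lp (Lp ℝ 2 m) 2 (timeMeasure T) → Lp (Lp ℝ 2 m) 2 (timeMeasure T)),
      Continuous N ∧ (∃ C M : ℝ, 0 ≤ M ∧ ∀ u, ‖N u‖ ≤ C + M * ‖u‖) ∧
      (∀ u, ∀ᵐ t ∂(timeMeasure T), N u t =ᵐ[m] fun x => f t x (u t x)) ∧
      (∀ u w, ∀ᵐ t ∂(timeMeasure T),
        0 ≤ ⟪lam • (u t - w t) - (N u t - N w t), u t - w t⟫) ∧
      ∀ ε : ℝ, 0 < ε → ∀ z, ∃ y, y + ε • (lam • y - N y) = z := by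
  obtain ⟨lam₀, hlam₀⟩ := hf.oneSidedLipschitz
  -- With `λ ≥ 0`, the function `λ y - f` stays monotone off `(0, T)`, where the extension of `f` is
  -- zero.
  set lam := max lam₀ 0 with hlamdef
  have hlam0 : 0 ≤ lam := le_max_right _ _
  have hlam : ∀ t ∈ Ioo 0 T, ∀ x y y', 0 ≤ (lam * (y - y') - (f t x y - f t x y')) * (y - y') := by
    intro t ht x y y'
    have h1 := hlam₀ t ht x y y'
    have h2 : lam₀ * |y - y'| ^ 2 ≤ lam * |y - y'| ^ 2 :=
      mul_le_mul_of_nonneg_right (le_max_left _ _) (sq_nonneg _)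
    rw [sq_abs] at h1 h2
    linarith
  have hf' := hf.isCaratheodory
  obtain ⟨N, hNc, hNg, hN⟩ := hf'.exists_nemytskii
  have hN' : ∀ u, ∀ᵐ t ∂(timeMeasure T), N u t =ᵐ[m] fun x => f t x (u t x) := by
    intro u
    filter_upwards [hN u, ae_restrict_mem measurableSet_Ioo] with t h1 ht
    exact h1.trans (Eventually.of_forall fun x => zeroExtend_of_mem ht _ _)
  refine ⟨lam, N, hNc, hNg, hN', fun u w => ?_, fun ε hε z => ?_⟩
  · filter_upwards [hN' u, hN' w, ae_restrict_mem measurableSet_Ioo] with t h1 h2 ht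
    rw [L2.inner_def]
    refine integral_nonneg_of_ae ?_
    filter_upwards [h1, h2, Lp.coeFn_sub (lam • (u t - w t)) (N u t - N w t),
      Lp.coeFn_smul lam (u t - w t), Lp.coeFn_sub (u t) (w t), Lp.coeFn_sub (N u t) (N w t)]
      with x h3 h4 h5 h6 h7 h8
    rw [h5, Pi.sub_apply, h6, Pi.smul_apply, h7, h8, Pi.sub_apply, Pi.sub_apply, h3, h4]
    have h9 := hlam t ht x (u t x) (w t x)
    rw [mul_comm] at h9
    exact h9
  · set k : ℝ → E → ℝ → ℝ := fun t x y => lam * y - zeroExtend T f t x y with hk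
    have hkc : IsCaratheodory m T k := by
      obtain ⟨M, ϱ, hM, hϱ, hle⟩ := hf'.growth
      refine ⟨((measurable_snd.comp measurable_snd).const_mul lam).sub hf'.measurable,
        fun t x => (continuous_const.mul continuous_id).sub (hf'.continuous t x),
        lam + M, ϱ, by positivity, hϱ, fun t ht x y => ?_⟩
      refine (abs_sub _ _).trans ?_
      rw [abs_mul, abs_of_nonneg hlam0]
      linarith [hle t ht x y]
    have hkm : ∀ t x y y', 0 ≤ (k t x y - k t x y') * (y - y') := by
      intro t x y y'
      by_cases ht : t ∈ Ioo 0 T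
      · simp only [hk, zeroExtend_of_mem ht]
        linarith [hlam t ht x y y']
      · simp only [hk, zeroExtend_of_notMem ht]
        nlinarith [mul_nonneg hlam0 (sq_nonneg (y - y'))]
    -- Solving `y + ε (λ y - f(t, x, y)) = z` pointwise is enough: the solution is again a
    -- Carathéodory function of linear growth, so its superposition operator solves the equation in
    -- `L²`.
    obtain ⟨j, hj, hjk⟩ := hkc.exists_resolvent hkm hε
    obtain ⟨J, -, -, hJ⟩ := hj.exists_nemytskii
    refine ⟨J z, Lp.ext ?_⟩
    filter_upwards [hJ z, hN (J z), Lp.coeFn_add (J z) (ε • (lam • J z - N (J z))),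
      Lp.coeFn_smul ε (lam • J z - N (J z)), Lp.coeFn_sub (lam • J z) (N (J z)),
      Lp.coeFn_smul lam (J z)] with t h1 h2 h3 h4 h5 h6
    rw [h3, Pi.add_apply, h4, Pi.smul_apply, h5, Pi.sub_apply, h6, Pi.smul_apply]
    refine Lp.ext ?_
    filter_upwards [h1, h2, Lp.coeFn_add (J z t) (ε • (lam • J z t - N (J z) t)),
      Lp.coeFn_smul ε (lam • J z t - N (J z) t), Lp.coeFn_sub (lam • J z t) (N (J z) t),
      Lp.coeFn_smul lam (J z t)] with x g1 g2 g3 g4 g5 g6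
    rw [g3, Pi.add_apply, g4, Pi.smul_apply, g5, Pi.sub_apply, g6, Pi.smul_apply, g2, g1]
    exact hjk t x (z t x)

end Nonlinearity

/-! ### The algebra of the exponential shift -/

section Shift

variable {X Y : Type*} [NormedAddCommGroup X] [InnerProductSpace ℝ X]
  [NormedAddCommGroup Y] [InnerProductSpace ℝ Y]

/-- `e` and `e'` stand for multiplication by `exp((1 + λ) t)`, which is symmetric, so it moves from
the test function to the unknown. Differentiating the exponential produces `(1 + λ) Q`. Its part `Q`
completes `B` to a coercive operator, and `λ Q` completes `-f` to a monotone one. The same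
derivative accounts for the extra term in `q₀` on the right. -/
theorem shift_identity (e Q : X →L[ℝ] X) (ι : X →L[ℝ] Y) (e' : Y →L[ℝ] Y)
    (he : ∀ u v, ⟪e u, v⟫ = ⟪u, e v⟫) (he' : ∀ u v, ⟪e' u, v⟫ = ⟪u, e' v⟫)
    (hι : ∀ u, ι (e u) = e' (ι u)) (hQ : ∀ u w, ⟪Q u, w⟫ = ⟪ι u, ι w⟫) (B : X →L[ℝ] X) {u : X}
    (hB : ∀ w, ⟪B u, e w⟫ = ⟪B (e u), w⟫) (n : Y) (z η p₀ q₀ : X) (lam : ℝ) :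
    ⟪e (z + (1 + lam) • Q η), u⟫ + ⟪B u, e η⟫
        = ⟪n, ι (e η)⟫ + (⟪p₀, e η⟫ + ⟪q₀, e (z + (1 + lam) • Q η)⟫) ↔
      ⟪z, e u⟫ + ⟪(B + Q) (e u), η⟫ + ⟪lam • ι (e u) - e' n, ι η⟫
        = ⟪e p₀ + (1 + lam) • Q (e q₀), η⟫ + ⟪e q₀, z⟫ := by
  have h1 : ⟪e (z + (1 + lam) • Q η), u⟫ = ⟪z, e u⟫ + (1 + lam) * ⟪ι (e u), ι η⟫ := by
    rw [he, inner_add_left, real_inner_smul_left, hQ, real_inner_comm (ι (e u))]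
  have h2 : ⟪q₀, e (z + (1 + lam) • Q η)⟫ = ⟪e q₀, z⟫ + (1 + lam) * ⟪ι (e q₀), ι η⟫ := by
    rw [← he, inner_add_right, real_inner_smul_right, real_inner_comm (Q η), hQ,
      real_inner_comm (ι (e q₀))]
  have h3 : ⟪n, ι (e η)⟫ = ⟪e' n, ι η⟫ := by rw [hι, he']
  have h4 : ⟪p₀, e η⟫ = ⟪e p₀, η⟫ := (he _ _).symm
  have h5 : ⟪(B + Q) (e u), η⟫ = ⟪B (e u), η⟫ + ⟪ι (e u), ι η⟫ := by
    rw [add_apply, inner_add_left, hQ]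
  have h6 : ⟪lam • ι (e u) - e' n, ι η⟫ = lam * ⟪ι (e u), ι η⟫ - ⟪e' n, ι η⟫ := by
    rw [inner_sub_left, real_inner_smul_left]
  have h7 : ⟪e p₀ + (1 + lam) • Q (e q₀), η⟫
      = ⟪e p₀, η⟫ + (1 + lam) * ⟪ι (e q₀), ι η⟫ := by
    rw [inner_add_left, real_inner_smul_left, hQ]
  rw [h1, h2, h3, h4, h5, h6, h7, hB]
  constructor <;> intro h <;> linarith

end Shift

/-! ### Representation of the data, reduction to the monotone equation, and conclusion -/

namespace FormFamily

variable {E : Type*} [MetricSpace E] [MeasurableSpace E] {m : Measure E} {T : ℝ}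

theorem IsContVersion.add {D : FormFamily m T} {u u' : D.L2V} {v v' : ℝ → Lp ℝ 2 m}
    (h : D.IsContVersion u v) (h' : D.IsContVersion u' v') :
    D.IsContVersion (u + u') (v + v') := by
  refine ⟨h.1.add h'.1, ?_⟩
  filter_upwards [h.2, h'.2, Lp.coeFn_add u u'] with t h1 h2 h3
  rw [h3, Pi.add_apply, Pi.add_apply, map_add, h1, h2]

theorem IsContVersion.smul {D : FormFamily m T} {u : D.L2V} {v : ℝ → Lp ℝ 2 m} (r : ℝ)
    (h : D.IsContVersion u v) : D.IsContVersion (r • u) (r • v) := by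
  refine ⟨h.1.const_smul r, ?_⟩
  filter_upwards [h.2, Lp.coeFn_smul r u] with t h1 h3
  rw [h3, Pi.smul_apply, Pi.smul_apply, map_smul, h1]

/-- Independence of the version is what makes the terminal value linear on `W₀`, although versions
are picked by choice. -/
theorem IsContVersion.end_eq {D : FormFamily m T} {u : D.L2V} {v v' : ℝ → Lp ℝ 2 m}
    (h : D.IsContVersion u v) (h' : D.IsContVersion u v') : v T = v' T :=
  ae_eq_extend_Icc D.T_pos (by filter_upwards [h.2, h'.2] with t h1 h2; rw [h1, h2]) h.1 h'.1
    ⟨D.T_pos.le, le_rfl⟩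

theorem norm_end_le (D : FormFamily m T) (p : D.W0) {v : ℝ → Lp ℝ 2 m}
    (hv : D.IsContVersion p.1.1 v) :
    ‖v T‖ ≤ √(2 * ‖(D.riesz.compLpL 2 (timeMeasure T) : D.L2V' →L[ℝ] D.L2V)‖) * ‖p‖ := by
  set R : D.L2V' →L[ℝ] D.L2V := D.riesz.compLpL 2 (timeMeasure T) with hR
  rw [← Real.sqrt_sq (norm_nonneg p), ← Real.sqrt_mul (by positivity)]
  refine Real.le_sqrt_of_sq_le ((D.norm_sq_end_le p hv).trans ?_)
  have h1 : ‖p.1.1‖ ≤ ‖p‖ := norm_fst_le p.1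
  have h2 : ‖p.1.2‖ ≤ ‖p‖ := norm_snd_le p.1
  have h3 : ⟪R p.1.2, p.1.1⟫ ≤ ‖R‖ * ‖p‖ * ‖p‖ := by
    refine (real_inner_le_norm _ _).trans ?_
    refine mul_le_mul ((R.le_opNorm _).trans ?_) h1 (norm_nonneg _) (by positivity)
    gcongr
  rw [← hR]
  linarith

/-- Every functional on `W₀`, plus a terminal datum, is `η ↦ ⟪p, η⟫ + ⟨∂_t η, q⟩`. -/
theorem exists_representation (D : FormFamily m T) (φ : Lp ℝ 2 m) (g : StrongDual ℝ D.W0) :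
    ∃ p₀ q₀ : D.L2V, ∀ (p : D.W0) (v : ℝ → Lp ℝ 2 m), D.IsContVersion p.1.1 v →
      ⟪φ, v T⟫ + g p = ⟪p₀, p.1.1⟫ + ⟪q₀, D.riesz.compLpL 2 (timeMeasure T) p.1.2⟫ := by
  choose v hv using fun p : D.W0 => p.2.2
  let τ : D.W0 →ₗ[ℝ] ℝ :=
    { toFun := fun p => ⟪φ, v p T⟫
      map_add' := fun p q => by
        rw [(hv (p + q)).1.end_eq ((hv p).1.add (hv q).1), Pi.add_apply, inner_add_right]
      map_smul' := fun r p => by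
        rw [(hv (r • p)).1.end_eq ((hv p).1.smul r), Pi.smul_apply, real_inner_smul_right]; rfl }
  let τ' : StrongDual ℝ D.W0 := τ.mkContinuous
    (‖φ‖ * √(2 * ‖(D.riesz.compLpL 2 (timeMeasure T) : D.L2V' →L[ℝ] D.L2V)‖)) fun p => by
      show ‖⟪φ, v p T⟫‖ ≤ _
      refine (norm_inner_le_norm φ (v p T)).trans ?_
      rw [mul_assoc]
      exact mul_le_mul_of_nonneg_left (D.norm_end_le p (hv p).1) (norm_nonneg _)
  -- `W₀` is a subspace of the product `L²(0,T;V) × L²(0,T;V')`. An extension to the product splits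
  -- into two functionals; the second is pulled back to `L²(0,T;V)` by the inverse `S` of the Riesz
  -- map, so that both have Riesz vectors there.
  obtain ⟨ℓ, hℓ, -⟩ := exists_extension_norm_eq D.W0 (τ' + g)
  let S : D.L2V →L[ℝ] D.L2V' :=
    (innerSL ℝ : D.Dom →L[ℝ] StrongDual ℝ D.Dom).compLpL 2 (timeMeasure T)
  have hS : ∀ ζ : D.L2V', S (D.riesz.compLpL 2 (timeMeasure T) ζ) = ζ := by
    intro ζ
    refine Lp.ext ?_
    filter_upwards [D.riesz.coeFn_compLpL ζ,
      (innerSL ℝ : D.Dom →L[ℝ] StrongDual ℝ D.Dom).coeFn_compLpL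
        (D.riesz.compLpL 2 (timeMeasure T) ζ)] with t h1 h2
    rw [h2, h1]
    ext ψ
    exact D.inner_riesz _ _
  refine ⟨(InnerProductSpace.toDual ℝ D.L2V).symm (ℓ.comp (ContinuousLinearMap.inl ℝ _ _)),
    (InnerProductSpace.toDual ℝ D.L2V).symm ((ℓ.comp (ContinuousLinearMap.inr ℝ _ _)).comp S),
    fun p w hw => ?_⟩
  rw [InnerProductSpace.toDual_symm_apply, InnerProductSpace.toDual_symm_apply]
  simp only [ContinuousLinearMap.comp_apply, ContinuousLinearMap.inl_apply,
    ContinuousLinearMap.inr_apply]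
  rw [hS, ← map_add, Prod.mk_add_mk, add_zero, zero_add]
  refine Eq.trans ?_ (hℓ p).symm
  rw [hw.end_eq (hv p).1]
  rfl

theorem expMap_mul_neg (κ t : ℝ) : expMap κ t * expMap (-κ) t = 1 := by
  rw [expMap_apply, expMap_apply, ← Real.exp_add]; simp

theorem expMap_neg_mul (κ t : ℝ) : expMap (-κ) t * expMap κ t = 1 := by
  rw [mul_comm, expMap_mul_neg]

/-- Multiplication by `exp (κ t)` on `W₀`. -/
def expW0 (D : FormFamily m T) (κ : ℝ) (p : D.W0) : D.W0 := ⟨_, D.timeMul_exp_mem_W0 κ p⟩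

/-- Every element of `W₀` is thus an exponential multiple of another, so testing with multiplied
functions loses nothing. -/
theorem expW0_expW0_neg (D : FormFamily m T) (κ : ℝ) (p : D.W0) :
    D.expW0 κ (D.expW0 (-κ) p) = p := by
  refine Subtype.ext (Prod.ext ?_ ?_)
  · exact timeMul_timeMul_of_mul_eq_one (expMap_mul_neg κ) _
  · simp only [expW0]
    rw [← timeMul_compLpL, ← map_smul (timeMul T (StrongDual ℝ D.Dom) (expMap (-κ))),
      ← map_add (timeMul T (StrongDual ℝ D.Dom) (expMap (-κ))),
      timeMul_timeMul_of_mul_eq_one (expMap_mul_neg κ), neg_smul, neg_add_cancel_right]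

theorem riesz_expW0 (D : FormFamily m T) (κ : ℝ) (p : D.W0) :
    D.riesz.compLpL 2 (timeMeasure T) (D.expW0 κ p).1.2
      = timeMul T D.Dom (expMap κ) (D.riesz.compLpL 2 (timeMeasure T) p.1.2
        + κ • D.gram.compLpL 2 (timeMeasure T) p.1.1) := by
  simp only [expW0]
  rw [← timeMul_compLpL, map_add, map_smul, riesz_toDual_compLpL]

/-- The weak formulation in terms of the superposition operator `N` of `f`. -/
theorem isWeakSolution_iff (D : FormFamily m T) {f : ℝ → E → ℝ → ℝ} {φ : Lp ℝ 2 m}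
    {g : StrongDual ℝ D.W0}
    {N : Lp (Lp ℝ 2 m) 2 (timeMeasure T) → Lp (Lp ℝ 2 m) 2 (timeMeasure T)}
    (hN : ∀ u, ∀ᵐ t ∂(timeMeasure T), N u t =ᵐ[m] fun x => f t x (u t x))
    {B : D.L2V →L[ℝ] D.L2V} (hB : ∀ u w, ⟪B u, w⟫ = ∫ t in Ioo 0 T, D.form t (u t) (w t))
    {p₀ q₀ : D.L2V} (hpq : ∀ (p : D.W0) (v : ℝ → Lp ℝ 2 m), D.IsContVersion p.1.1 v →
      ⟪φ, v T⟫ + g p = ⟪p₀, p.1.1⟫ + ⟪q₀, D.riesz.compLpL 2 (timeMeasure T) p.1.2⟫)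
    (u : D.L2V) :
    D.IsWeakSolution f φ g u ↔ ∀ p : D.W0,
      ⟪D.riesz.compLpL 2 (timeMeasure T) p.1.2, u⟫ + ⟪B u, p.1.1⟫
        = ⟪N (D.toL2H u), D.toL2H p.1.1⟫
          + (⟪p₀, p.1.1⟫ + ⟪q₀, D.riesz.compLpL 2 (timeMeasure T) p.1.2⟫) := by
  have hNu : ∀ᵐ t ∂(timeMeasure T), N (D.toL2H u) t =ᵐ[m] fun x => f t x (D.toH (u t) x) := by
    filter_upwards [hN (D.toL2H u), D.toH.coeFn_compLpL u] with t h1 h2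
    rwa [h2] at h1
  have hinner : ∀ (F : Lp (Lp ℝ 2 m) 2 (timeMeasure T)) (η : D.L2V),
      ∫ t in Ioo 0 T, ⟪F t, D.toH (η t)⟫ = ⟪F, D.toL2H η⟫ := by
    intro F η
    rw [L2.inner_def]
    refine integral_congr_ae ?_
    filter_upwards [D.toH.coeFn_compLpL η] with t h1
    rw [h1]
  constructor
  · rintro ⟨F, hF, heq⟩ p
    obtain ⟨v, hv, -⟩ := p.2.2
    have hFN : F = N (D.toL2H u) := by
      refine Lp.ext ?_
      filter_upwards [hF, hNu] with t h1 h2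
      exact Lp.ext (h1.trans h2.symm)
    have h1 := heq p v hv
    rw [← hB, ← inner_riesz_compLpL, hinner, hFN] at h1
    rw [← hpq p v hv, h1]
    ring
  · intro h
    refine ⟨N (D.toL2H u), hNu, fun p v hv => ?_⟩
    rw [← hB, ← inner_riesz_compLpL, hinner, h p, ← hpq p v hv]
    ring

/-- The exponential shift `u ↦ exp (κ t) u` turns the weak formulation into a monotone equation. -/
theorem shifted_equation_iff (D : FormFamily m T) (lam : ℝ)
    (N : Lp (Lp ℝ 2 m) 2 (timeMeasure T) → Lp (Lp ℝ 2 m) 2 (timeMeasure T))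
    {B : D.L2V →L[ℝ] D.L2V} (hB : ∀ u w, ⟪B u, w⟫ = ∫ t in Ioo 0 T, D.form t (u t) (w t))
    (p₀ q₀ u : D.L2V) :
    (∀ p : D.W0, ⟪D.riesz.compLpL 2 (timeMeasure T) p.1.2, u⟫ + ⟪B u, p.1.1⟫
        = ⟪N (D.toL2H u), D.toL2H p.1.1⟫
          + (⟪p₀, p.1.1⟫ + ⟪q₀, D.riesz.compLpL 2 (timeMeasure T) p.1.2⟫)) ↔
    ∀ p : D.W0, ⟪D.riesz.compLpL 2 (timeMeasure T) p.1.2, timeMul T _ (expMap (1 + lam)) u⟫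
        + ⟪(B + D.gram.compLpL 2 (timeMeasure T)) (timeMul T _ (expMap (1 + lam)) u), p.1.1⟫
        + ⟪lam • D.toL2H (timeMul T _ (expMap (1 + lam)) u) - timeMul T _ (expMap (1 + lam))
            (N (timeMul T _ (expMap (-(1 + lam)))
              (D.toL2H (timeMul T _ (expMap (1 + lam)) u)))), D.toL2H p.1.1⟫
      = ⟪timeMul T _ (expMap (1 + lam)) p₀ + (1 + lam) • D.gram.compLpL 2 (timeMeasure T)
            (timeMul T _ (expMap (1 + lam)) q₀), p.1.1⟫
        + ⟪timeMul T _ (expMap (1 + lam)) q₀, D.riesz.compLpL 2 (timeMeasure T) p.1.2⟫ := by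
  set κ := 1 + lam with hκ
  set U := timeMul T D.Dom (expMap κ) u with hU
  have hUι : timeMul T _ (expMap (-κ)) (D.toL2H U) = D.toL2H u := by
    rw [hU, ← timeMul_compLpL, timeMul_timeMul_of_mul_eq_one (expMap_neg_mul κ)]
  have hBE : ∀ w, ⟪B u, timeMul T _ (expMap κ) w⟫ = ⟪B U, w⟫ := by
    intro w
    rw [hB, hB]
    refine integral_congr_ae ?_
    filter_upwards [coeFn_timeMul (expMap κ) w, coeFn_timeMul (expMap κ) u] with t h1 h2
    rw [h1, h2, map_smul, map_smul, LinearMap.smul_apply]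
  have key : ∀ p : D.W0,
      (⟪D.riesz.compLpL 2 (timeMeasure T) (D.expW0 κ p).1.2, u⟫ + ⟪B u, (D.expW0 κ p).1.1⟫
        = ⟪N (D.toL2H u), D.toL2H (D.expW0 κ p).1.1⟫
          + (⟪p₀, (D.expW0 κ p).1.1⟫
            + ⟪q₀, D.riesz.compLpL 2 (timeMeasure T) (D.expW0 κ p).1.2⟫)) ↔
      ⟪D.riesz.compLpL 2 (timeMeasure T) p.1.2, U⟫
        + ⟪(B + D.gram.compLpL 2 (timeMeasure T)) U, p.1.1⟫
        + ⟪lam • D.toL2H U - timeMul T _ (expMap κ)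
            (N (timeMul T _ (expMap (-κ)) (D.toL2H U))), D.toL2H p.1.1⟫
      = ⟪timeMul T _ (expMap κ) p₀ + κ • D.gram.compLpL 2 (timeMeasure T)
            (timeMul T _ (expMap κ) q₀), p.1.1⟫
        + ⟪timeMul T _ (expMap κ) q₀, D.riesz.compLpL 2 (timeMeasure T) p.1.2⟫ := by
    intro p
    have h1 : (D.expW0 κ p).1.1 = timeMul T _ (expMap κ) p.1.1 := rfl
    rw [hUι, riesz_expW0, h1]
    exact shift_identity _ _ _ _ (inner_timeMul _) (inner_timeMul _)
      (fun w => (timeMul_compLpL D.toH (expMap κ) w).symm) D.inner_gram_compLpL B hBE _ _ _ _ _ _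
  constructor
  · intro h p
    exact (key p).mp (h _)
  · intro h p
    have h1 := (key (D.expW0 (-κ) p)).mpr (h _)
    rwa [expW0_expW0_neg] at h1

/-- `λ - f`, conjugated by a multiplier, is monotone. -/
theorem conjugate_monotone {H : Type*} [NormedAddCommGroup H] [InnerProductSpace ℝ H] {lam : ℝ}
    {N : Lp H 2 (timeMeasure T) → Lp H 2 (timeMeasure T)}
    (hN : ∀ u w, ∀ᵐ t ∂(timeMeasure T),
      0 ≤ ⟪lam • (u t - w t) - (N u t - N w t), u t - w t⟫) (κ : ℝ)
    (y y' : Lp H 2 (timeMeasure T)) :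
    0 ≤ ⟪(lam • y - timeMul T _ (expMap κ) (N (timeMul T _ (expMap (-κ)) y)))
      - (lam • y' - timeMul T _ (expMap κ) (N (timeMul T _ (expMap (-κ)) y'))), y - y'⟫ := by
  obtain ⟨u, rfl⟩ : ∃ u, timeMul T _ (expMap κ) u = y :=
    ⟨_, timeMul_timeMul_of_mul_eq_one (expMap_mul_neg κ) y⟩
  obtain ⟨w, rfl⟩ : ∃ w, timeMul T _ (expMap κ) w = y' :=
    ⟨_, timeMul_timeMul_of_mul_eq_one (expMap_mul_neg κ) y'⟩
  rw [timeMul_timeMul_of_mul_eq_one (expMap_neg_mul κ),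
    timeMul_timeMul_of_mul_eq_one (expMap_neg_mul κ)]
  have h1 : (lam • timeMul T _ (expMap κ) u - timeMul T _ (expMap κ) (N u))
      - (lam • timeMul T _ (expMap κ) w - timeMul T _ (expMap κ) (N w))
      = timeMul T _ (expMap κ) (lam • (u - w) - (N u - N w)) := by
    simp only [map_sub, map_smul, smul_sub]
    abel
  rw [h1, ← map_sub, L2.inner_def]
  refine integral_nonneg_of_ae ?_
  filter_upwards [hN u w, coeFn_timeMul (expMap κ) (lam • (u - w) - (N u - N w)),
    coeFn_timeMul (expMap κ) (u - w), Lp.coeFn_sub (lam • (u - w)) (N u - N w),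
    Lp.coeFn_smul lam (u - w), Lp.coeFn_sub u w, Lp.coeFn_sub (N u) (N w)]
    with t g1 g2 g3 g4 g5 g6 g7
  rw [g2, g3, g4, Pi.sub_apply, g5, Pi.smul_apply, g6, g7, Pi.sub_apply, Pi.sub_apply,
    real_inner_smul_left, real_inner_smul_right]
  have h2 : 0 ≤ expMap κ t := (Real.exp_pos _).le
  exact mul_nonneg h2 (mul_nonneg h2 g1)

/-- The abstract equation is applied with `a p = η` and `c p` the Riesz image of `∂_t η`, for the
unknown `exp((1 + λ) t) u`. Continuity, monotonicity, linear growth and surjectivity of `1 + ε N`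
all survive conjugation by the exponential; for monotonicity this uses that the inequality for `λ -
f` holds at almost every time, not merely after integration. -/
theorem existsUnique_isWeakSolution (D : FormFamily m T) [SFinite m]
    [SecondCountableTopology (Lp ℝ 2 m)] {f : ℝ → E → ℝ → ℝ} (hf : IsAdmissible m T f)
    (φ : Lp ℝ 2 m) (g : StrongDual ℝ D.W0) : ∃! u : D.L2V, D.IsWeakSolution f φ g u := by
  obtain ⟨lam, N, hNc, ⟨C, M, hM, hNg⟩, hN, hNmon, hNsurj⟩ := hf.exists_operator
  obtain ⟨B, hB, α, hα, hcoer⟩ := D.exists_formOp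
  obtain ⟨p₀, q₀, hpq⟩ := D.exists_representation φ g
  simp only [D.isWeakSolution_iff hN hB hpq, D.shifted_equation_iff lam N hB p₀ q₀]
  set κ := 1 + lam
  set e := timeMul T (Lp ℝ 2 m) (expMap κ) with he
  set e' := timeMul T (Lp ℝ 2 m) (expMap (-κ)) with he'
  have hee' : ∀ y, e (e' y) = y := timeMul_timeMul_of_mul_eq_one (expMap_mul_neg κ)
  have he'e : ∀ y, e' (e y) = y := timeMul_timeMul_of_mul_eq_one (expMap_neg_mul κ)
  obtain ⟨U, hU, huniq⟩ := existsUnique_adjoint_equation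
    (((LinearMap.fst ℝ D.L2V D.L2V').comp D.W0.subtype : D.W0 →ₗ[ℝ] D.L2V))
    (((D.riesz.compLpL 2 (timeMeasure T) : D.L2V' →L[ℝ] D.L2V) : D.L2V' →ₗ[ℝ] D.L2V).comp
      ((LinearMap.snd ℝ D.L2V D.L2V').comp D.W0.subtype))
    D.timeDeriv_monotone D.timeDeriv_adjoint_monotone D.toL2H
    (B + D.gram.compLpL 2 (timeMeasure T)) hα (fun u => by
      rw [add_apply, inner_add_left, inner_gram_compLpL,
        real_inner_self_eq_norm_sq]
      exact hcoer u)
    (N := fun y => lam • y - e (N (e' y)))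
    ((continuous_const_smul lam).sub (e.continuous.comp (hNc.comp e'.continuous)))
    (conjugate_monotone hNmon κ) (C := ‖e‖ * C) (M := |lam| + ‖e‖ * (M * ‖e'‖))
    (by positivity) (fun y => by
      refine (norm_sub_le _ _).trans ?_
      rw [norm_smul, Real.norm_eq_abs]
      have h1 : ‖e (N (e' y))‖ ≤ ‖e‖ * (C + M * (‖e'‖ * ‖y‖)) := by
        refine (e.le_opNorm _).trans (mul_le_mul_of_nonneg_left ((hNg _).trans ?_) (norm_nonneg _))
        exact add_le_add_right (mul_le_mul_of_nonneg_left (e'.le_opNorm y) hM) _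
      linarith)
    (fun ε hε z => by
      obtain ⟨y, hy⟩ := hNsurj ε hε (e' z)
      refine ⟨e y, ?_⟩
      rw [he'e, ← hee' z, ← hy]
      simp only [map_add, map_smul, map_sub])
    (timeMul T _ (expMap κ) p₀ + κ • D.gram.compLpL 2 (timeMeasure T)
      (timeMul T _ (expMap κ) q₀)) (timeMul T _ (expMap κ) q₀)
  have hUU : timeMul T D.Dom (expMap κ) (timeMul T D.Dom (expMap (-κ)) U) = U :=
    timeMul_timeMul_of_mul_eq_one (expMap_mul_neg κ) U
  refine ⟨timeMul T D.Dom (expMap (-κ)) U, fun p => ?_, fun w hw => ?_⟩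
  · rw [hUU]
    exact hU p
  · rw [← huniq (timeMul T D.Dom (expMap κ) w) hw]
    exact (timeMul_timeMul_of_mul_eq_one (expMap_neg_mul κ) w).symm

end FormFamily

end ParabolicDirichlet

end

theorem mainTheorem4 {E : Type*} [MetricSpace E] [LocallyCompactSpace E]
    [TopologicalSpace.SeparableSpace E] [MeasurableSpace E] [BorelSpace E]
    (m : MeasureTheory.Measure E) [MeasureTheory.IsFiniteMeasureOnCompacts m]
    [m.IsOpenPosMeasure] (T : ℝ) (D : ParabolicDirichlet.FormFamily m T)
    (f : ℝ → E → ℝ → ℝ) (hf : ParabolicDirichlet.IsAdmissible m T f)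
    (φ : MeasureTheory.Lp ℝ 2 m) (g : StrongDual ℝ D.W0) :
    ∃! u : D.L2V, D.IsWeakSolution f φ g u := by
  -- Second countability makes `m`, being finite on compact sets, σ-finite, and together with `2 ≠
  -- ∞` it makes `L²(E;m)` separable.
  have : SecondCountableTopology E := UniformSpace.secondCountable_of_separable E
  have : Fact ((2 : ENNReal) ≠ ⊤) := ⟨by norm_num⟩
  exact D.existsUnique_isWeakSolution hf φ g
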